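/- Let $k$ be a field, $H$ a Hopf algebra over $k$ with coproduct $\Delta(h)=\sum h_1\otimes h_2$, and let $\mathcal P$ be a locally trivial quantum principal fibre bundle with structure Hopf algebra $H$: an algebra $B$ with a finite complete covering by ideals $J_i$ ($i\in I$; that is, $\bigcap_i J_i=0$, and every family of elements compatible modulo $J_i+J_j$ comes from a global element), $B_i=B/J_i$ with projections $\pi_i$, a right $H$-comodule algebra $(\mathcal P,\Delta_{\mathcal P})$, $\Delta_{\mathcal P}(f)=\sum f_0\otimes f_1$, an injective homomorphism $\iota:B\to\mathcal P$ whose image is the algebra of coinvariants, and surjective homomorphisms $\chi_i:\mathcal P\to B_i\otimes H$ with $\chi_i\circ\iota=\pi_i\otimes 1$ and $(\chi_i\otimes \mathrm{id})\circ\Delta_{\mathcal P}=(\mathrm{id}\otimes\Delta)\circ\chi_i$, whose kernels form a complete covering of $\mathcal P$. Let a differential structure on $\mathcal P$ be given, i.e. differential algebras $\Gamma(B_i)$ over $B_i$ and a right covariant differential algebra $\Gamma(H)$ over $H$ (each generated by its degree zero part and the differentials of it). Let $\Gamma(\mathcal P)$ be the differential algebra generated by $\mathcal P$ to which all $\chi_i$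 extend as $\chi_{i}:\Gamma(\mathcal P)\to\Gamma(B_i)\hat\otimes\Gamma(H)$ with $\bigcap_i\ker\chi_{i}=0$. Let $\Gamma_c(\mathcal P)$ be its covering completion (the families in $\prod_i\Gamma(B_i)\hat\otimes\Gamma(H)$ that are compatible in $\Gamma(\mathcal P)/(\ker\chi_{i}+\ker\chi_{j})$), let $\mathrm{hor}\,\Gamma_c(\mathcal P)$ be the subalgebra of the families with all components in $\Gamma(B_i)\otimes H$, with the coaction $\gamma\mapsto\sum\gamma_0\otimes\gamma_1$ given locally by $\mathrm{id}\otimes\Delta$, and let $\Gamma_m(B)$ be the algebra of the families in $\Gamma_c(\mathcal P)$ with all components in $\Gamma(B_i)\otimes 1$. A left (right) gauge transformation of $B_i\otimes H$ is a bijective left (right) $B_i\otimes 1$-linear map that commutes with the coaction $\mathrm{id}\otimes\Delta$ and is the identity on $B_i\otimes 1$; a left (right) gauge transformation of $\mathcal P$ is a left (right) $\iota(B)$-module automorphism $\alpha$ of $\mathcal P$ with $\chi_i\circ\alpha=\alpha_i\circ\chi_i$ for gauge transformations $\alpha_i$ of $B_i\otimes H$ of the same kind. A left (right) covariant derivative is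 an $H$-colinear map $D:\mathrm{hor}\,\Gamma_c(\mathcal P)\to\mathrm{hor}\,\Gamma_c(\mathcal P)$ of degree $1$ with $D(1)=0$ that maps the horizontal forms with vanishing $i$-th component to such forms, for every $i$, and satisfies $D(\beta\gamma)=(d\beta)\gamma+(-1)^{n}\beta D(\gamma)$ for $\beta\in\Gamma_m^n(B)$ and $\gamma\in\mathrm{hor}\,\Gamma_c(\mathcal P)$ (in the right case $D(\gamma\beta)=D(\gamma)\beta+(-1)^n\gamma\, d\beta$ for $\gamma\in\mathrm{hor}\,\Gamma^n_c(\mathcal P)$ and $\beta\in\Gamma_m(B)$). Its curvature form is the linear map $\Omega:H\to\mathrm{hor}\,\Gamma_c^2(\mathcal P)$ with $D^2(f)=\sum f_0\Omega(f_1)$ (right case: $D^2(f)=\sum\Omega(f_1)f_0$) for all $f\in\mathcal P$. Left case. Let $\alpha$ be a left gauge transformation and $D$ a left covariant derivative. There are unique linear maps $g_{\alpha},g_{\alpha^{-1}}:H\to\mathcal P$ with $\alpha(f)=\sum f_0g_\alpha(f_1)$ and $\alpha^{-1}(f)=\sum f_0g_{\alpha^{-1}}(f_1)$ for $f\in\mathcal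 P$; the map $\gamma\mapsto\sum\gamma_0g_\alpha(\gamma_1)$ is a linear automorphism of $\mathrm{hor}\,\Gamma_c(\mathcal P)$, again denoted $\alpha$; $D'=\alpha\circ D\circ\alpha^{-1}$ is a left covariant derivative with $(D')^2=\alpha\circ D^2\circ\alpha^{-1}$; $D$ and $D'$ have unique curvature forms $\Omega$ and $\Omega'$; and for all $h\in H$ $$\Omega'(h)=\sum g_{\alpha^{-1}}(h_1)\,\Omega(h_2)\,g_\alpha(h_3).$$ Right case. Suppose that the antipode of $H$ is bijective, and let $\alpha$ be a right gauge transformation and $D$ a right covariant derivative. Then the same holds with right covariant derivatives, $\alpha(f)=\sum g_\alpha(f_1)f_0$, $\alpha^{-1}(f)=\sum g_{\alpha^{-1}}(f_1)f_0$, the extension $\gamma\mapsto\sum g_\alpha(\gamma_1)\gamma_0$ of $\alpha$, and $$\Omega'(h)=\sum g_\alpha(h_3)\,\Omega(h_2)\,g_{\alpha^{-1}}(h_1).$$ -/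

import Mathlib

open scoped TensorProduct

noncomputable section

namespace QPFB

/-! ### Coverings -/

/-- A complete covering of an algebra `R` by a family of ideals: the ideals have zero intersection
and every family of local elements, compatible modulo `J i ⊔ J j`, comes from an element of `R`. -/
def IsCompleteCovering {R I : Type*} [Ring R] (J : I → Ideal R) : Prop :=
  (⨅ i, J i = ⊥) ∧
    ∀ a : I → R, (∀ i j, a i - a j ∈ J i ⊔ J j) → ∃ r : R, ∀ i, r - a i ∈ J i

/-! ### Differential algebras -/

universe u v w u₁ u₂ u₃ u₄ w₁ w₂

/-- A differential algebra over `A`: an `ℕ`-graded algebra with degree zero part `A`, a differential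
of degree one that is a graded derivation of square zero, generated by `A` and `d A`. -/
structure DifferentialAlgebra (k : Type u) [Field k] (A : Type v) [Ring A] [Algebra k A] where
  /-- the forms -/
  Form : Type w
  [ring : Ring Form]
  [algebra : Algebra k Form]
  /-- the forms of a given degree -/
  deg : ℕ → Submodule k Form
  [graded : GradedAlgebra deg]
  /-- the inclusion of the functions -/
  incl : A →ₐ[k] Form
  incl_injective : Function.Injective incl
  range_incl : LinearMap.range incl.toLinearMap = deg 0
  /-- the differential -/
  d : Form →ₗ[k] Form
  d_mem : ∀ n, ∀ x ∈ deg n, d x ∈ deg (n + 1)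
  d_d : ∀ x, d (d x) = 0
  leibniz : ∀ n, ∀ x ∈ deg n, ∀ y, d (x * y) = d x * y + (-1 : k) ^ n • (x * d y)
  generated : Algebra.adjoin k (Set.range incl ∪ Set.range (fun a => d (incl a))) = ⊤

attribute [instance] DifferentialAlgebra.ring DifferentialAlgebra.algebra
  DifferentialAlgebra.graded

/-- The linear map that multiplies forms of degree `n` by `(-1) ^ n`. -/
def DifferentialAlgebra.sign {k : Type*} [Field k] {A : Type*} [Ring A] [Algebra k A]
    (Γ : DifferentialAlgebra k A) : Γ.Form →ₗ[k] Γ.Form :=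
  DirectSum.toModule k ℕ Γ.Form (fun n => (-1 : k) ^ n • (Γ.deg n).subtype) ∘ₗ
    (DirectSum.decomposeLinearEquiv Γ.deg).toLinearMap

theorem DifferentialAlgebra.sign_of_mem {k : Type*} [Field k] {A : Type*} [Ring A] [Algebra k A]
    (Γ : DifferentialAlgebra k A) (n : ℕ) (x : Γ.Form) (hx : x ∈ Γ.deg n) :
    Γ.sign x = (-1 : k) ^ n • x := by
  lift x to Γ.deg n using hx
  simp [DifferentialAlgebra.sign, DirectSum.toModule_lof]

/-- The differential `d (γ ⊗ ρ) = dγ ⊗ ρ + (-1) ^ n γ ⊗ dρ` (`n` the degree of `γ`) on the graded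
tensor product of two differential algebras. -/
def tensorD {k : Type*} [Field k] {A A' : Type*} [Ring A] [Algebra k A] [Ring A'] [Algebra k A']
    (Γ : DifferentialAlgebra k A) (Γ' : DifferentialAlgebra k A') :
    (Γ.deg ᵍ⊗[k] Γ'.deg) →ₗ[k] (Γ.deg ᵍ⊗[k] Γ'.deg) :=
  (GradedTensorProduct.of k Γ.deg Γ'.deg).toLinearMap ∘ₗ
    (Γ.d.rTensor Γ'.Form + TensorProduct.map Γ.sign Γ'.d) ∘ₗ
    (GradedTensorProduct.of k Γ.deg Γ'.deg).symm.toLinearMap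

/-- A right covariant differential algebra over a Hopf algebra `H`: the coproduct extends to a
homomorphism of graded algebras `Γ(H) → Γ(H) ⊗ H` that commutes with the differential. -/
structure RightCovariantDifferentialAlgebra (k : Type u) [Field k] (H : Type v) [Ring H]
    [HopfAlgebra k H] extends DifferentialAlgebra.{u, v, w} k H where
  /-- the coaction of `H` on the forms -/
  coact : Form →ₐ[k] Form ⊗[k] H
  coact_incl : ∀ h, coact (incl h) = incl.toLinearMap.rTensor H (Coalgebra.comul (R := k) h)
  coact_deg : ∀ n, ∀ x ∈ deg n, coact x ∈ LinearMap.range ((deg n).subtype.rTensor H)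
  coact_d : ∀ x, coact (d x) = d.rTensor H (coact x)

/-! ### Locally trivial quantum principal fibre bundles -/

/-- The coaction `id ⊗ Δ` of `H` on `V ⊗ H`. -/
def trivCoact (k : Type*) [Field k] (H : Type*) [Ring H] [HopfAlgebra k H]
    (V : Type*) [AddCommGroup V] [Module k V] : V ⊗[k] H →ₗ[k] (V ⊗[k] H) ⊗[k] H :=
  (TensorProduct.assoc k V H H).symm.toLinearMap ∘ₗ (Coalgebra.comul (R := k)).lTensor V

/-- A locally trivial quantum principal fibre bundle with total space algebra `P`, base algebra `B`,
structure Hopf algebra `H`, and local trivializations `χ i : P → B_i ⊗ H`, where `B_i = B / J_i`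
is given by its projection `π i` with kernel `J_i`. -/
structure Bundle (k : Type*) [Field k] (B H P : Type*) [Ring B] [Algebra k B] [Ring H]
    [HopfAlgebra k H] [Ring P] [Algebra k P] {I : Type*} (Bi : I → Type*)
    [∀ i, Ring (Bi i)] [∀ i, Algebra k (Bi i)] where
  /-- the projections to the local base algebras -/
  π : ∀ i, B →ₐ[k] Bi i
  π_surjective : ∀ i, Function.Surjective (π i)
  base_covering : IsCompleteCovering fun i => RingHom.ker (π i)
  /-- the coaction of the structure Hopf algebra on the total space -/
  coact : P →ₐ[k] P ⊗[k] H
  coact_coassoc : (TensorProduct.assoc k P H H).toLinearMap ∘ₗ coact.toLinearMap.rTensor H ∘ₗ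
    coact.toLinearMap = (Coalgebra.comul (R := k)).lTensor P ∘ₗ coact.toLinearMap
  coact_counit : (TensorProduct.rid k P).toLinearMap ∘ₗ
    (Coalgebra.counit (R := k) (A := H)).lTensor P ∘ₗ coact.toLinearMap = LinearMap.id
  /-- the inclusion of the base -/
  ι : B →ₐ[k] P
  ι_injective : Function.Injective ι
  /-- the base consists of the coinvariants -/
  mem_range_ι : ∀ f : P, f ∈ Set.range ι ↔ coact f = f ⊗ₜ[k] 1
  /-- the local trivializations -/
  χ : ∀ i, P →ₐ[k] Bi i ⊗[k] H
  χ_surjective : ∀ i, Function.Surjective (χ i)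
  χ_ι : ∀ i b, χ i (ι b) = π i b ⊗ₜ[k] 1
  χ_coact : ∀ i, (χ i).toLinearMap.rTensor H ∘ₗ coact.toLinearMap =
    trivCoact k H (Bi i) ∘ₗ (χ i).toLinearMap
  total_covering : IsCompleteCovering fun i => RingHom.ker (χ i)

section

variable {k : Type*} [Field k] {B H P : Type*} [Ring B] [Algebra k B] [Ring H] [HopfAlgebra k H]
  [Ring P] [Algebra k P] {I : Type*} {Bi : I → Type*} [∀ i, Ring (Bi i)] [∀ i, Algebra k (Bi i)]

/-! ### Gauge transformations -/

/-- Left gauge transformations of the trivial bundle `A ⊗ H`. -/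
structure IsTrivLeftGauge {A : Type*} [Ring A] [Algebra k A]
    (α : (A ⊗[k] H) ≃ₗ[k] (A ⊗[k] H)) : Prop where
  module : ∀ (a : A) (x : A ⊗[k] H), α ((a ⊗ₜ 1) * x) = (a ⊗ₜ 1) * α x
  coact : α.toLinearMap.rTensor H ∘ₗ trivCoact k H A = trivCoact k H A ∘ₗ α.toLinearMap
  base : ∀ a : A, α (a ⊗ₜ 1) = a ⊗ₜ 1

/-- Right gauge transformations of the trivial bundle `A ⊗ H`. -/
structure IsTrivRightGauge {A : Type*} [Ring A] [Algebra k A]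
    (α : (A ⊗[k] H) ≃ₗ[k] (A ⊗[k] H)) : Prop where
  module : ∀ (a : A) (x : A ⊗[k] H), α (x * (a ⊗ₜ 1)) = α x * (a ⊗ₜ 1)
  coact : α.toLinearMap.rTensor H ∘ₗ trivCoact k H A = trivCoact k H A ∘ₗ α.toLinearMap
  base : ∀ a : A, α (a ⊗ₜ 1) = a ⊗ₜ 1

/-- Left gauge transformations of a locally trivial bundle: left module isomorphisms that are
given by gauge transformations in the local trivializations. -/
structure IsLeftGauge (Q : Bundle k B H P Bi) (α : P ≃ₗ[k] P) : Prop where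
  module : ∀ (b : B) (f : P), α (Q.ι b * f) = Q.ι b * α f
  local_triv : ∃ αi : ∀ i, (Bi i ⊗[k] H) ≃ₗ[k] (Bi i ⊗[k] H),
    ∀ i, IsTrivLeftGauge (αi i) ∧ ∀ f, Q.χ i (α f) = αi i (Q.χ i f)

/-- Right gauge transformations of a locally trivial bundle. -/
structure IsRightGauge (Q : Bundle k B H P Bi) (α : P ≃ₗ[k] P) : Prop where
  module : ∀ (b : B) (f : P), α (f * Q.ι b) = α f * Q.ι b
  local_triv : ∃ αi : ∀ i, (Bi i ⊗[k] H) ≃ₗ[k] (Bi i ⊗[k] H),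
    ∀ i, IsTrivRightGauge (αi i) ∧ ∀ f, Q.χ i (α f) = αi i (Q.χ i f)

/-- `g : H → P` is the map associated to the left gauge transformation `α`:
`α f = ∑ f₀ g(f₁)`. -/
def IsLeftGaugeMap (Q : Bundle k B H P Bi) (α : P ≃ₗ[k] P) (g : H →ₗ[k] P) : Prop :=
  ∀ f, α f = LinearMap.mul' k P (g.lTensor P (Q.coact f))

/-- `g : H → P` is the map associated to the right gauge transformation `α`:
`α f = ∑ g(f₁) f₀`. -/
def IsRightGaugeMap (Q : Bundle k B H P Bi) (α : P ≃ₗ[k] P) (g : H →ₗ[k] P) : Prop :=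
  ∀ f, α f = LinearMap.mul' k P (TensorProduct.comm k P P (g.lTensor P (Q.coact f)))

end

/-! ### Differential structures and forms on the total space -/

/-- A differential structure on a locally trivial bundle: differential algebras `Γ(B_i)` on the
local base algebras and a right covariant differential algebra `Γ(H)` on the structure Hopf
algebra; they determine the differential algebra `totalForms` over `P`. -/
structure DifferentialStructure {k : Type u} [Field k] {B : Type u₁} {H : Type v} {P : Type u₂}
    [Ring B] [Algebra k B] [Ring H] [HopfAlgebra k H] [Ring P] [Algebra k P] {I : Type u₃}
    {Bi : I → Type u₄} [∀ i, Ring (Bi i)] [∀ i, Algebra k (Bi i)] (Q : Bundle k B H P Bi) where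
  /-- the forms on the local base algebras -/
  base : ∀ i, DifferentialAlgebra.{u, u₄, w₁} k (Bi i)
  /-- the forms on the structure Hopf algebra -/
  fibre : RightCovariantDifferentialAlgebra.{u, v, w₂} k H

namespace DifferentialStructure

variable {k : Type*} [Field k] {B H P : Type*} [Ring B] [Algebra k B] [Ring H] [HopfAlgebra k H]
  [Ring P] [Algebra k P] {I : Type*} {Bi : I → Type*} [∀ i, Ring (Bi i)] [∀ i, Algebra k (Bi i)]
  {Q : Bundle k B H P Bi} (S : DifferentialStructure Q)

/-- The forms `Γ(B_i) ⊗ Γ(H)` (graded tensor product) on the trivial bundle `B_i ⊗ H`. -/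
abbrev LocForm (i : I) : Type _ := (S.base i).deg ᵍ⊗[k] S.fibre.deg

/-- The inclusion of `Γ(B_i) ⊗ H` in `Γ(B_i) ⊗ Γ(H)`. -/
def horIncl (i : I) : (S.base i).Form ⊗[k] H →ₗ[k] S.LocForm i :=
  (GradedTensorProduct.of k (S.base i).deg S.fibre.deg).toLinearMap ∘ₗ
    S.fibre.incl.toLinearMap.lTensor (S.base i).Form

/-- The coaction `id ⊗ Δ` of `H` on `Γ(B_i) ⊗ Γ(H)`. -/
def locCoact (i : I) : S.LocForm i →ₗ[k] S.LocForm i ⊗[k] H :=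
  (GradedTensorProduct.of k (S.base i).deg S.fibre.deg).toLinearMap.rTensor H ∘ₗ
    (TensorProduct.assoc k (S.base i).Form S.fibre.Form H).symm.toLinearMap ∘ₗ
    S.fibre.coact.toLinearMap.lTensor (S.base i).Form ∘ₗ
    (GradedTensorProduct.of k (S.base i).deg S.fibre.deg).symm.toLinearMap

/-- Families of forms on the local trivializations; the operations are componentwise. -/
abbrev LocForms : Type _ := ∀ i, S.LocForm i

/-- The componentwise differential. -/
def locD : S.LocForms →ₗ[k] S.LocForms :=
  LinearMap.pi fun i => tensorD (S.base i) S.fibre.toDifferentialAlgebra ∘ₗ LinearMap.proj i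

/-- An element of the total space as a family of local forms of degree zero. -/
def funLin : P →ₗ[k] S.LocForms :=
  LinearMap.pi fun i => S.horIncl i ∘ₗ
    (S.base i).incl.toLinearMap.rTensor H ∘ₗ (Q.χ i).toLinearMap

/-- The differential algebra `Γ(P)`. It is the differential algebra generated by `P` to which all
the local trivializations extend as `Γ(P) → Γ(B_i) ⊗ Γ(H)`, the kernels of the extensions having
zero intersection; so it is the algebra of families of local forms generated by `P` and `d P`. -/
def totalForms : Subalgebra k S.LocForms :=
  Algebra.adjoin k (Set.range S.funLin ∪ Set.range (fun f => S.locD (S.funLin f)))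

/-- The extension `Γ(P) → Γ(B_i) ⊗ Γ(H)` of the local trivialization `χ i`. -/
def χForm (i : I) : S.totalForms →ₐ[k] S.LocForm i :=
  (Pi.evalAlgHom k (fun i => S.LocForm i) i).comp S.totalForms.val

/-- The covering completion `Γ_c(P)` of `Γ(P)`: families of local forms that are compatible on
the overlaps, that is, in `Γ(P)` modulo `ker χ_i + ker χ_j`. -/
def completedForms : Subalgebra k S.LocForms where
  carrier := {γ | ∃ a : I → S.totalForms, (∀ i, S.χForm i (a i) = γ i) ∧
    ∀ i j, a i - a j ∈ RingHom.ker (S.χForm i) ⊔ RingHom.ker (S.χForm j)}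
  add_mem' := by
    rintro x y ⟨a, ha, ha'⟩ ⟨b, hb, hb'⟩
    refine ⟨a + b, fun i => by simp [ha, hb], fun i j => ?_⟩
    have := add_mem (ha' i j) (hb' i j)
    rwa [sub_add_sub_comm] at this
  mul_mem' := by
    rintro x y ⟨a, ha, ha'⟩ ⟨b, hb, hb'⟩
    refine ⟨a * b, fun i => by simp [ha, hb], fun i j => ?_⟩
    have h1 : a i * (b i - b j) ∈ RingHom.ker (S.χForm i) ⊔ RingHom.ker (S.χForm j) :=
      Ideal.mul_mem_left _ _ (hb' i j)
    have h2 : (a i - a j) * b j ∈ RingHom.ker (S.χForm i) ⊔ RingHom.ker (S.χForm j) := by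
      obtain ⟨u, hu, v, hv, huv⟩ := Submodule.mem_sup.1 (ha' i j)
      rw [← huv, add_mul]
      refine Submodule.add_mem_sup ?_ ?_
      · rw [RingHom.mem_ker] at hu ⊢
        rw [map_mul, hu, zero_mul]
      · rw [RingHom.mem_ker] at hv ⊢
        rw [map_mul, hv, zero_mul]
    have := add_mem h1 h2
    rwa [mul_sub, sub_mul, sub_add_sub_cancel] at this
  algebraMap_mem' r :=
    ⟨fun _ => algebraMap k _ r, fun i => by rw [AlgHom.commutes]; rfl, fun i j => by simp⟩

theorem horIncl_tmul (i : I) (x : (S.base i).Form) (h : H) :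
    S.horIncl i (x ⊗ₜ h) =
      GradedTensorProduct.of k (S.base i).deg S.fibre.deg (x ⊗ₜ S.fibre.incl h) := rfl

theorem horIncl_mul_tmul (i : I) (x y : (S.base i).Form) (g h : H) :
    S.horIncl i (x ⊗ₜ g) * S.horIncl i (y ⊗ₜ h) = S.horIncl i ((x * y) ⊗ₜ (g * h)) := by
  have hg : S.fibre.incl g ∈ S.fibre.deg 0 := by
    rw [← S.fibre.range_incl]; exact ⟨g, rfl⟩
  induction y using DirectSum.Decomposition.inductionOn (ℳ := (S.base i).deg) with
  | zero => simp
  | homogeneous y =>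
    simp only [horIncl_tmul, map_mul]
    exact GradedTensorProduct.tmul_zero_coe_mul_coe_tmul _ _ x ⟨_, hg⟩ y (S.fibre.incl h)
  | add y z hy hz => rw [TensorProduct.add_tmul, map_add, mul_add, hy, hz, ← map_add,
      ← TensorProduct.add_tmul, mul_add]

/-- `Γ(B_i) ⊗ H → Γ(B_i) ⊗ Γ(H)` is multiplicative. -/
theorem horIncl_mul (i : I) (x y : (S.base i).Form ⊗[k] H) :
    S.horIncl i x * S.horIncl i y = S.horIncl i (x * y) := by
  induction x with
  | zero => simp
  | add x x' hx hx' => rw [map_add, add_mul, hx, hx', add_mul, map_add]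
  | tmul x g =>
    induction y with
    | zero => simp
    | add y y' hy hy' => rw [map_add, mul_add, hy, hy', mul_add, map_add]
    | tmul y h => rw [horIncl_mul_tmul, Algebra.TensorProduct.tmul_mul_tmul]

theorem horIncl_one (i : I) : S.horIncl i 1 = 1 := by
  rw [Algebra.TensorProduct.one_def, horIncl_tmul, map_one]
  rfl

/-- The algebra `hor Γ_c(P)` of horizontal forms: those that lie in `Γ(B_i) ⊗ H` locally. -/
def hor : Subalgebra k S.LocForms where
  carrier := {γ | γ ∈ S.completedForms ∧ ∀ i, γ i ∈ LinearMap.range (S.horIncl i)}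
  add_mem' := fun hx hy => ⟨add_mem hx.1 hy.1, fun i => add_mem (hx.2 i) (hy.2 i)⟩
  mul_mem' := by
    rintro x y hx hy
    refine ⟨mul_mem hx.1 hy.1, fun i => ?_⟩
    obtain ⟨a, ha⟩ := hx.2 i
    obtain ⟨b, hb⟩ := hy.2 i
    exact ⟨a * b, by rw [← horIncl_mul, ha, hb, Pi.mul_apply]⟩
  algebraMap_mem' r := ⟨S.completedForms.algebraMap_mem r, fun i =>
    ⟨r • 1, by
      rw [map_smul, horIncl_one, Pi.algebraMap_apply, Algebra.algebraMap_eq_smul_one]⟩⟩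

/-- The horizontal forms of degree `n`. -/
def horDeg (n : ℕ) : Submodule k S.hor where
  carrier := {γ | ∀ i, (γ : S.LocForms) i ∈
    LinearMap.range (S.horIncl i ∘ₗ ((S.base i).deg n).subtype.rTensor H)}
  add_mem' := fun hx hy i => add_mem (hx i) (hy i)
  zero_mem' := fun _ => zero_mem _
  smul_mem' := fun r _ hx i => Submodule.smul_mem _ r (hx i)

/-- The forms of degree `n` in `Γ_m(B)`, the maximal embeddable differential algebra over the base:
families of forms `γ_i` in `Γ(B_i)` such that the family of the `γ_i ⊗ 1` lies in `Γ_c(P)`. It is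
viewed as a subalgebra of `hor Γ_c(P)`. -/
def baseDeg (n : ℕ) : Submodule k S.hor where
  carrier := {γ | ∀ i, ∃ x ∈ (S.base i).deg n, (γ : S.LocForms) i = S.horIncl i (x ⊗ₜ 1)}
  add_mem' := by
    intro x y hx hy i
    obtain ⟨a, ha, ha'⟩ := hx i
    obtain ⟨b, hb, hb'⟩ := hy i
    exact ⟨a + b, add_mem ha hb, by
      rw [TensorProduct.add_tmul, map_add, ← ha', ← hb']; rfl⟩
  zero_mem' := fun _ => ⟨0, zero_mem _, by simp⟩
  smul_mem' := by
    intro r x hx i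
    obtain ⟨a, ha, ha'⟩ := hx i
    exact ⟨r • a, Submodule.smul_mem _ r ha, by
      rw [← TensorProduct.smul_tmul', map_smul, ← ha']; rfl⟩

theorem funLin_one : S.funLin 1 = 1 := by
  funext i
  simp only [funLin, LinearMap.pi_apply, LinearMap.comp_apply, AlgHom.toLinearMap_apply, map_one]
  rw [Algebra.TensorProduct.one_def, LinearMap.rTensor_tmul, AlgHom.toLinearMap_apply, map_one,
    ← Algebra.TensorProduct.one_def, horIncl_one]
  rfl

theorem funLin_mul (f g : P) : S.funLin (f * g) = S.funLin f * S.funLin g := by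
  funext i
  simp only [funLin, LinearMap.pi_apply, LinearMap.comp_apply, AlgHom.toLinearMap_apply, map_mul,
    Pi.mul_apply, horIncl_mul]
  congr 1
  exact map_mul (Algebra.TensorProduct.map (S.base i).incl (AlgHom.id k H)) _ _

theorem funLin_mem (f : P) : S.funLin f ∈ S.hor :=
  ⟨⟨fun _ => ⟨S.funLin f, Algebra.subset_adjoin (Or.inl ⟨f, rfl⟩)⟩, fun _ => rfl,
    fun i j => by simp⟩, fun _ => ⟨_, rfl⟩⟩

/-- The inclusion of the total space algebra `P` in the horizontal forms. -/
def ofTotal : P →ₐ[k] S.hor :=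
  AlgHom.codRestrict (AlgHom.ofLinearMap S.funLin S.funLin_one S.funLin_mul) S.hor S.funLin_mem

/-! ### The coaction on horizontal forms -/

theorem locCoact_tmul (i : I) (x : (S.base i).Form) (y : S.fibre.Form) :
    S.locCoact i (GradedTensorProduct.of k _ _ (x ⊗ₜ y)) =
      (GradedTensorProduct.of k (S.base i).deg S.fibre.deg).toLinearMap.rTensor H
        ((TensorProduct.assoc k _ _ _).symm (x ⊗ₜ S.fibre.coact y)) := rfl

theorem locCoact_mul_aux (i : I) (x x' : (S.base i).Form) (m n : ℕ) (hx' : x' ∈ (S.base i).deg m)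
    (z z' : S.fibre.Form ⊗[k] H)
    (hz : z ∈ LinearMap.range ((S.fibre.deg n).subtype.rTensor H)) :
    (GradedTensorProduct.of k (S.base i).deg S.fibre.deg).toLinearMap.rTensor H
        ((TensorProduct.assoc k _ _ _).symm (x ⊗ₜ z)) *
      (GradedTensorProduct.of k (S.base i).deg S.fibre.deg).toLinearMap.rTensor H
        ((TensorProduct.assoc k _ _ _).symm (x' ⊗ₜ z')) =
    (-1 : ℤˣ) ^ (n * m) •
      (GradedTensorProduct.of k (S.base i).deg S.fibre.deg).toLinearMap.rTensor H
        ((TensorProduct.assoc k _ _ _).symm ((x * x') ⊗ₜ (z * z'))) := by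
  obtain ⟨w, rfl⟩ := hz
  induction w with
  | zero => simp
  | add w w' h h' =>
    simp only [map_add, TensorProduct.tmul_add, add_mul, h, h', smul_add]
  | tmul w g =>
    induction z' with
    | zero => simp
    | add w w' h h' =>
      simp only [map_add, TensorProduct.tmul_add, mul_add, h, h', smul_add]
    | tmul w' g' =>
      have := GradedTensorProduct.tmul_coe_mul_coe_tmul (R := k) (S.base i).deg S.fibre.deg x w
        ⟨x', hx'⟩ w'
      simp only [LinearMap.rTensor_tmul, TensorProduct.assoc_symm_tmul,
        Algebra.TensorProduct.tmul_mul_tmul, Submodule.subtype_apply, LinearEquiv.coe_coe]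
      exact (congrArg (fun t => t ⊗ₜ[k] (g * g')) this).trans
        (map_zsmul ((TensorProduct.mk k _ H).flip (g * g')) _ _)

theorem locCoact_mul (i : I) (x y : S.LocForm i) :
    S.locCoact i (x * y) = S.locCoact i x * S.locCoact i y := by
  obtain ⟨x, rfl⟩ := (GradedTensorProduct.of k (S.base i).deg S.fibre.deg).surjective x
  obtain ⟨y, rfl⟩ := (GradedTensorProduct.of k (S.base i).deg S.fibre.deg).surjective y
  induction x with
  | zero => simp
  | add x x' h h' => simp only [map_add, add_mul, h, h']
  | tmul x r =>
    induction y with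
    | zero => simp
    | add y y' h h' => simp only [map_add, mul_add, h, h']
    | tmul y r' =>
      induction r using DirectSum.Decomposition.inductionOn (ℳ := S.fibre.deg) with
      | zero => simp
      | add r s h h' => simp only [map_add, TensorProduct.tmul_add, add_mul, h, h']
      | @homogeneous n r =>
        induction y using DirectSum.Decomposition.inductionOn (ℳ := (S.base i).deg) with
        | zero => simp
        | add r s h h' => simp only [map_add, TensorProduct.add_tmul, mul_add, h, h']
        | @homogeneous m y =>
          have := GradedTensorProduct.tmul_coe_mul_coe_tmul (R := k) (S.base i).deg S.fibre.deg x r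
            y r'
          rw [this, locCoact_tmul, locCoact_tmul,
            locCoact_mul_aux S i x y m n y.2 _ _ (S.fibre.coact_deg n r r.2), ← map_mul,
            ← locCoact_tmul]
          simp only [Units.smul_def]
          exact map_zsmul (S.locCoact i) _ _

theorem locCoact_one (i : I) : S.locCoact i 1 = 1 := by
  have h : (1 : S.LocForm i) = GradedTensorProduct.of k (S.base i).deg S.fibre.deg (1 ⊗ₜ 1) := rfl
  rw [h, locCoact_tmul, map_one, Algebra.TensorProduct.one_def, TensorProduct.assoc_symm_tmul]
  rfl

theorem locCoact_horIncl (i : I) (c : (S.base i).Form ⊗[k] H) :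
    S.locCoact i (S.horIncl i c) = (S.horIncl i).rTensor H (trivCoact k H _ c) := by
  induction c with
  | zero => simp
  | add a b ha hb => rw [map_add, map_add, ha, hb, map_add, map_add]
  | tmul x h =>
    rw [horIncl_tmul, locCoact_tmul, S.fibre.coact_incl]
    simp only [trivCoact, LinearMap.comp_apply, LinearMap.lTensor_tmul, LinearEquiv.coe_coe]
    induction (Coalgebra.comul (R := k) h) with
    | zero => simp
    | add a b ha hb => simp only [map_add, TensorProduct.tmul_add, ha, hb]
    | tmul a b => rfl

theorem trivCoact_rTensor {V W : Type*} [AddCommGroup V] [Module k V] [AddCommGroup W] [Module k W]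
    (φ : V →ₗ[k] W) (c : V ⊗[k] H) :
    trivCoact k H W (φ.rTensor H c) = (φ.rTensor H).rTensor H (trivCoact k H V c) := by
  induction c with
  | zero => simp
  | add a b ha hb => simp only [map_add, ha, hb]
  | tmul x h =>
    simp only [trivCoact, LinearMap.comp_apply, LinearMap.lTensor_tmul, LinearEquiv.coe_coe,
      LinearMap.rTensor_tmul]
    induction (Coalgebra.comul (R := k) h) with
    | zero => simp
    | add a b ha hb => simp only [map_add, TensorProduct.tmul_add, ha, hb]
    | tmul a b => rfl

/-- The coaction on `P` is the restriction of the coaction on local forms. -/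
theorem locCoact_funLin (i : I) (f : P) :
    S.locCoact i (S.funLin f i) = (LinearMap.proj i ∘ₗ S.funLin).rTensor H (Q.coact f) := by
  have h1 : S.funLin f i = S.horIncl i ((S.base i).incl.toLinearMap.rTensor H (Q.χ i f)) := rfl
  have h2 : LinearMap.proj i ∘ₗ S.funLin = S.horIncl i ∘ₗ
    (S.base i).incl.toLinearMap.rTensor H ∘ₗ (Q.χ i).toLinearMap := rfl
  have h3 := LinearMap.congr_fun (Q.χ_coact i) f
  simp only [LinearMap.comp_apply, AlgHom.toLinearMap_apply] at h3
  rw [h1, h2, locCoact_horIncl, trivCoact_rTensor, ← h3, LinearMap.rTensor_comp,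
    LinearMap.rTensor_comp]
  rfl

theorem locCoact_d (i : I) (x : S.LocForm i) :
    S.locCoact i (tensorD (S.base i) S.fibre.toDifferentialAlgebra x) =
      (tensorD (S.base i) S.fibre.toDifferentialAlgebra).rTensor H (S.locCoact i x) := by
  obtain ⟨x, rfl⟩ := (GradedTensorProduct.of k (S.base i).deg S.fibre.deg).surjective x
  induction x with
  | zero => simp
  | add x x' h h' => simp only [map_add, h, h']
  | tmul x r =>
    have h : tensorD (S.base i) S.fibre.toDifferentialAlgebra
        (GradedTensorProduct.of k (S.base i).deg S.fibre.deg (x ⊗ₜ r)) =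
        GradedTensorProduct.of k (S.base i).deg S.fibre.deg ((S.base i).d x ⊗ₜ r) +
        GradedTensorProduct.of k (S.base i).deg S.fibre.deg ((S.base i).sign x ⊗ₜ S.fibre.d r) :=
      rfl
    rw [h, map_add, locCoact_tmul, locCoact_tmul, locCoact_tmul, S.fibre.coact_d]
    induction (S.fibre.coact r) with
    | zero => simp
    | add a b ha hb =>
      simp only [map_add, TensorProduct.tmul_add] at ha hb ⊢
      rw [← ha, ← hb]
      abel
    | tmul a b => exact (TensorProduct.add_tmul _ _ _).symm

/-- `Γ(P)` is right covariant. -/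
theorem exists_total_coact (γ : S.LocForms) (hγ : γ ∈ S.totalForms) :
    ∃ w : S.totalForms ⊗[k] H, ∀ i,
      Algebra.TensorProduct.map (S.χForm i) (AlgHom.id k H) w = S.locCoact i (γ i) := by
  induction hγ using Algebra.adjoin_induction with
  | mem x hx =>
    obtain ⟨f, rfl⟩ | ⟨f, rfl⟩ := hx
    · let φ : P →ₗ[k] S.totalForms := S.funLin.codRestrict (Subalgebra.toSubmodule S.totalForms)
        fun f => Algebra.subset_adjoin (Or.inl ⟨f, rfl⟩)
      refine ⟨φ.rTensor H (Q.coact f), fun i => ?_⟩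
      rw [locCoact_funLin]
      exact (LinearMap.congr_fun (LinearMap.rTensor_comp H (S.χForm i).toLinearMap φ) _).symm
    · let φ : P →ₗ[k] S.totalForms := (S.locD ∘ₗ S.funLin).codRestrict
        (Subalgebra.toSubmodule S.totalForms)
        fun f => Algebra.subset_adjoin (Or.inr ⟨f, rfl⟩)
      refine ⟨φ.rTensor H (Q.coact f), fun i => ?_⟩
      have h : S.locD (S.funLin f) i =
        tensorD (S.base i) S.fibre.toDifferentialAlgebra (S.funLin f i) := rfl
      change _ = S.locCoact i (S.locD (S.funLin f) i)
      rw [h, locCoact_d, locCoact_funLin, ← LinearMap.comp_apply, ← LinearMap.rTensor_comp]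
      exact (LinearMap.congr_fun (LinearMap.rTensor_comp H (S.χForm i).toLinearMap φ) _).symm
  | algebraMap r =>
    refine ⟨r • 1, fun i => ?_⟩
    rw [map_smul, map_one, Pi.algebraMap_apply, Algebra.algebraMap_eq_smul_one, map_smul,
      locCoact_one]
  | add x y _ _ hx hy =>
    obtain ⟨a, ha⟩ := hx
    obtain ⟨b, hb⟩ := hy
    exact ⟨a + b, fun i => by rw [map_add, ha, hb, Pi.add_apply, map_add]⟩
  | mul x y _ _ hx hy =>
    obtain ⟨a, ha⟩ := hx
    obtain ⟨b, hb⟩ := hy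
    exact ⟨a * b, fun i => by rw [map_mul, ha, hb, Pi.mul_apply, locCoact_mul]⟩

/-- Contraction of the second factor of `V ⊗ H` with a functional on `H`. -/
def contract {V : Type*} [AddCommGroup V] [Module k V] (φ : H →ₗ[k] k) : V ⊗[k] H →ₗ[k] V :=
  (TensorProduct.rid k V).toLinearMap ∘ₗ φ.lTensor V

theorem contract_rTensor {V W : Type*} [AddCommGroup V] [Module k V] [AddCommGroup W] [Module k W]
    (φ : H →ₗ[k] k) (f : V →ₗ[k] W) (x : V ⊗[k] H) :
    contract φ (f.rTensor H x) = f (contract φ x) := by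
  induction x with
  | zero => simp
  | add a b ha hb => simp only [map_add, ha, hb]
  | tmul a b => simp [contract]

theorem contract_mem_completedForms (φ : H →ₗ[k] k) (γ : S.LocForms) (hγ : γ ∈ S.completedForms) :
    (fun i => contract φ (S.locCoact i (γ i))) ∈ S.completedForms := by
  have key : ∀ a : S.totalForms, ∃ b : S.totalForms, ∀ i,
      S.χForm i b = contract φ (S.locCoact i (S.χForm i a)) := by
    intro a
    obtain ⟨w, hw⟩ := S.exists_total_coact a.1 a.2
    refine ⟨contract φ w, fun i => ?_⟩
    exact (contract_rTensor φ (S.χForm i).toLinearMap w).symm.trans (congrArg _ (hw i))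
  choose T hT using key
  obtain ⟨a, ha, ha'⟩ := hγ
  refine ⟨fun i => T (a i), fun i => by rw [hT, ha], fun i j => ?_⟩
  obtain ⟨u, hu, v, hv, huv⟩ := Submodule.mem_sup.1 (ha' i j)
  rw [RingHom.mem_ker] at hu hv
  have hT' : T (a i) - T (a j) = T u + T v := by
    apply Subtype.ext
    funext l
    change S.χForm l (T (a i) - T (a j)) = S.χForm l (T u + T v)
    rw [map_sub, map_add, hT, hT, hT, hT, ← map_sub, ← map_sub, ← map_add, ← map_add, ← map_add,
      ← map_sub, huv]
  rw [hT']
  refine Submodule.add_mem_sup ?_ ?_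
  · rw [RingHom.mem_ker, hT, hu, map_zero, map_zero]
  · rw [RingHom.mem_ker, hT, hv, map_zero, map_zero]

theorem contract_mem_hor (φ : H →ₗ[k] k) (γ : S.LocForms) (hγ : γ ∈ S.hor) :
    (fun i => contract φ (S.locCoact i (γ i))) ∈ S.hor := by
  refine ⟨S.contract_mem_completedForms φ γ hγ.1, fun i => ?_⟩
  obtain ⟨c, hc⟩ := hγ.2 i
  exact ⟨contract φ (trivCoact k H _ c), by
    change _ = contract φ (S.locCoact i (γ i))
    rw [← hc, locCoact_horIncl, contract_rTensor]⟩

/-- A horizontal form tensored with an element of `H`, as a family of local forms. -/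
def horTensorLoc : S.hor ⊗[k] H →ₗ[k] ∀ i, S.LocForm i ⊗[k] H :=
  LinearMap.pi fun i => (LinearMap.proj i ∘ₗ S.hor.val.toLinearMap).rTensor H

theorem ext_contract {V : Type*} [AddCommGroup V] [Module k V] (x y : V ⊗[k] H)
    (h : ∀ φ : H →ₗ[k] k, contract φ x = contract φ y) : x = y := by
  classical
  apply (TensorProduct.equivFinsuppOfBasisRight (Module.Basis.ofVectorSpace k H)).injective
  ext b
  rw [TensorProduct.equivFinsuppOfBasisRight_apply, TensorProduct.equivFinsuppOfBasisRight_apply]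
  exact h _

theorem horTensorLoc_injective : Function.Injective S.horTensorLoc := by
  intro x y hxy
  refine ext_contract x y fun φ => Subtype.ext (funext fun i => ?_)
  have := congrArg (contract φ) (congrFun hxy i)
  simp only [horTensorLoc, LinearMap.pi_apply, contract_rTensor] at this
  exact this

theorem exists_horCoact [Finite I] (γ : S.hor) :
    ∃ x, S.horTensorLoc x = fun i => S.locCoact i ((γ : S.LocForms) i) := by
  classical
  cases nonempty_fintype I
  let b := Module.Basis.ofVectorSpace k H
  let e : ∀ i, S.LocForm i ⊗[k] H ≃ₗ[k] _ := fun i =>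
    TensorProduct.equivFinsuppOfBasisRight (M := S.LocForm i) b
  let c : ∀ i, _ := fun i => e i (S.locCoact i ((γ : S.LocForms) i))
  let s := Finset.univ.biUnion fun i => (c i).support
  refine ⟨∑ j ∈ s, ⟨_, S.contract_mem_hor (b.coord j) γ γ.2⟩ ⊗ₜ b j, ?_⟩
  funext i
  rw [map_sum, Finset.sum_apply]
  apply (e i).injective
  ext l
  rw [map_sum, Finsupp.finsetSum_apply]
  have h : ∀ j, (e i (S.horTensorLoc (⟨_, S.contract_mem_hor (b.coord j) γ γ.2⟩ ⊗ₜ b j) i)) l =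
      if j = l then c i l else 0 := by
    intro j
    have h1 : c i j = contract (b.coord j) (S.locCoact i ((γ : S.LocForms) i)) :=
      TensorProduct.equivFinsuppOfBasisRight_apply b _ _
    have h2 : S.horTensorLoc (⟨_, S.contract_mem_hor (b.coord j) γ γ.2⟩ ⊗ₜ b j) i =
      c i j ⊗ₜ b j := by rw [h1]; rfl
    rw [h2, TensorProduct.equivFinsuppOfBasisRight_apply_tmul_apply, b.repr_self,
      Finsupp.single_apply]
    split_ifs with hjl
    · rw [hjl, one_smul]
    · rw [zero_smul]
  simp only [h, Finset.sum_ite_eq', s, Finset.mem_biUnion, Finset.mem_univ, true_and]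
  split_ifs with hl
  · rfl
  · by_contra hne
    exact hl ⟨i, Finsupp.mem_support_iff.2 fun h0 => hne h0.symm⟩

/-- The coaction `hor Γ_c(P) → hor Γ_c(P) ⊗ H`, given locally by `id ⊗ Δ`. -/
def horCoact [Finite I] : S.hor →ₗ[k] S.hor ⊗[k] H :=
  (LinearEquiv.ofInjective S.horTensorLoc S.horTensorLoc_injective).symm.toLinearMap ∘ₗ
    LinearMap.codRestrict (LinearMap.range S.horTensorLoc)
      (LinearMap.pi fun i => S.locCoact i ∘ₗ LinearMap.proj i ∘ₗ S.hor.val.toLinearMap)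
      S.exists_horCoact

theorem horCoact_spec [Finite I] (γ : S.hor) (i : I) :
    (LinearMap.proj i ∘ₗ S.hor.val.toLinearMap).rTensor H (S.horCoact γ) =
      S.locCoact i ((γ : S.LocForms) i) := by
  have h : S.horTensorLoc (S.horCoact γ) = fun i => S.locCoact i ((γ : S.LocForms) i) :=
    congrArg Subtype.val
      ((LinearEquiv.ofInjective S.horTensorLoc S.horTensorLoc_injective).apply_symm_apply _)
  exact congrFun h i

/-! ### Gauge transformations on horizontal forms, covariant derivatives, curvature -/

/-- The map `γ ↦ ∑ γ₀ g(γ₁)` on horizontal forms. -/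
def leftExtend [Finite I] (g : H →ₗ[k] P) : S.hor →ₗ[k] S.hor :=
  LinearMap.mul' k S.hor ∘ₗ (S.ofTotal.toLinearMap ∘ₗ g).lTensor S.hor ∘ₗ S.horCoact

/-- The map `γ ↦ ∑ g(γ₁) γ₀` on horizontal forms. -/
def rightExtend [Finite I] (g : H →ₗ[k] P) : S.hor →ₗ[k] S.hor :=
  LinearMap.mul' k S.hor ∘ₗ (TensorProduct.comm k S.hor S.hor).toLinearMap ∘ₗ
    (S.ofTotal.toLinearMap ∘ₗ g).lTensor S.hor ∘ₗ S.horCoact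

/-- Left covariant derivatives. -/
structure IsLeftCovariantDerivative [Finite I] (D : S.hor →ₗ[k] S.hor) : Prop where
  degree : ∀ n, ∀ γ ∈ S.horDeg n, D γ ∈ S.horDeg (n + 1)
  one : D 1 = 0
  leibniz : ∀ n, ∀ β ∈ S.baseDeg n, ∀ γ : S.hor, (D (β * γ) : S.LocForms) =
    S.locD (β : S.LocForms) * (γ : S.LocForms) +
      (-1 : k) ^ n • ((β : S.LocForms) * (D γ : S.LocForms))
  covariant : D.rTensor H ∘ₗ S.horCoact = S.horCoact ∘ₗ D
  local_ker : ∀ i, ∀ γ : S.hor, (γ : S.LocForms) i = 0 → (D γ : S.LocForms) i = 0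

/-- Right covariant derivatives. -/
structure IsRightCovariantDerivative [Finite I] (D : S.hor →ₗ[k] S.hor) : Prop where
  degree : ∀ n, ∀ γ ∈ S.horDeg n, D γ ∈ S.horDeg (n + 1)
  one : D 1 = 0
  leibniz : ∀ n, ∀ γ ∈ S.horDeg n, ∀ m, ∀ β ∈ S.baseDeg m, (D (γ * β) : S.LocForms) =
    (D γ : S.LocForms) * (β : S.LocForms) +
      (-1 : k) ^ n • ((γ : S.LocForms) * S.locD (β : S.LocForms))
  covariant : D.rTensor H ∘ₗ S.horCoact = S.horCoact ∘ₗ D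
  local_ker : ∀ i, ∀ γ : S.hor, (γ : S.LocForms) i = 0 → (D γ : S.LocForms) i = 0

/-- `Ω : H → hor Γ_c²(P)` is the curvature form of the left covariant derivative `D`:
`D² f = ∑ f₀ Ω(f₁)` for `f` in `P`. -/
structure IsLeftCurvatureForm (D : S.hor →ₗ[k] S.hor) (Ω : H →ₗ[k] S.hor) : Prop where
  degree : ∀ h, Ω h ∈ S.horDeg 2
  sq : ∀ f : P, D (D (S.ofTotal f)) =
    LinearMap.mul' k S.hor (TensorProduct.map S.ofTotal.toLinearMap Ω (Q.coact f))

/-- `Ω : H → hor Γ_c²(P)` is the curvature form of the right covariant derivative `D`: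
`D² f = ∑ Ω(f₁) f₀` for `f` in `P`. -/
structure IsRightCurvatureForm (D : S.hor →ₗ[k] S.hor) (Ω : H →ₗ[k] S.hor) : Prop where
  degree : ∀ h, Ω h ∈ S.horDeg 2
  sq : ∀ f : P, D (D (S.ofTotal f)) =
    LinearMap.mul' k S.hor (TensorProduct.comm k S.hor S.hor
      (TensorProduct.map S.ofTotal.toLinearMap Ω (Q.coact f)))

end DifferentialStructure

/-- The convolution `h ↦ ∑ a(h₁) b(h₂)`. -/
def conv {k : Type*} [Field k] {H : Type*} [Ring H] [HopfAlgebra k H] {R : Type*} [Ring R]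
    [Algebra k R] (a b : H →ₗ[k] R) : H →ₗ[k] R :=
  LinearMap.mul' k R ∘ₗ TensorProduct.map a b ∘ₗ Coalgebra.comul (R := k)

/-- The twisted convolution `h ↦ ∑ a(h₂) b(h₁)`. -/
def twistedConv {k : Type*} [Field k] {H : Type*} [Ring H] [HopfAlgebra k H] {R : Type*} [Ring R]
    [Algebra k R] (a b : H →ₗ[k] R) : H →ₗ[k] R :=
  LinearMap.mul' k R ∘ₗ TensorProduct.map a b ∘ₗ (TensorProduct.comm k H H).toLinearMap ∘ₗ
    Coalgebra.comul (R := k)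

end QPFB

end

/-! Everything rests on one correspondence. Let `F` be a linear operator from `P` to `P` or to the
horizontal forms that is linear over the base on one side and local, so that the `i`-th component of
`F f` vanishes when `χ_i f` does. Then `F f = ∑ f₀ T(f₁)` for exactly one linear map `T` on `H`. In
a trivialization, base linearity reduces `F` to the elements `1 ⊗ h`, and convolution with `h ↦ 1 ⊗
h` is inverted by the antipode: `T(h) = ∑ (1 ⊗ S h₁) F(1 ⊗ h₂)`. The same inversion modulo larger
subspaces shows that the local solutions agree on overlaps, and completeness of the covering glues
them (`mem_of_act_mem`, `exists_act`, `act_injective`). Applied to `α` this yields `g_α`. Applied to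
`D²`, which is base linear because the cross terms of the Leibniz rule cancel and `d² = 0`, it
yields `Ω`.

On horizontal forms, `γ ↦ ∑ γ₀ g(γ₁)` is locally the extension of scalars of `α_i` from `B_i ⊗ H` to
`Γ(B_i) ⊗ H`. Bijectivity, colinearity and preservation of degree are therefore inherited from
`α_i`. Forms on the base pass through the extension, which makes `D'` a covariant derivative.

The formula for `Ω'` is then a computation with colinear maps: `D² α⁻¹ f = ∑ α⁻¹(f₀) Ω(f₁) = ∑ f₀
g_{α⁻¹}(f₁) Ω(f₂)`, and applying `α` multiplies by `g_α` of the last leg (`IsCurvature.conj`).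
Uniqueness of the curvature form finishes the argument.

Both cases are treated at once: a Boolean selects the multiplication or its opposite. For the
opposite multiplication the role of the antipode is played by its inverse, which is why the right
case needs bijectivity. -/

noncomputable section

namespace QPFB

/-! ### Convolution and comodule actions for both orders of multiplication. -/

section Sided

variable {k : Type*} [Field k] {H : Type*} [Ring H] [HopfAlgebra k H]

/-- The multiplication of `R` for `s = true`, the opposite multiplication for `s = false`. -/
def sideMul (k : Type*) [Field k] (s : Bool) (R : Type*) [Ring R] [Algebra k R] :
    R →ₗ[k] R →ₗ[k] R :=
  bif s then LinearMap.mul k R else (LinearMap.mul k R).flip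

variable {R : Type*} [Ring R] [Algebra k R] {R' : Type*} [Ring R'] [Algebra k R']
  {V : Type*} [AddCommMonoid V] [Module k V] {W : Type*} [AddCommMonoid W] [Module k W]

theorem sideMul_assoc (s : Bool) (x y z : R) :
    sideMul k s R (sideMul k s R x y) z = sideMul k s R x (sideMul k s R y z) := by
  cases s <;> simp [sideMul, mul_assoc]

theorem sideMul_one_left (s : Bool) (x : R) : sideMul k s R 1 x = x := by
  cases s <;> simp [sideMul]

theorem sideMul_one_right (s : Bool) (x : R) : sideMul k s R x 1 = x := by
  cases s <;> simp [sideMul]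

theorem map_sideMul (s : Bool) (φ : R →ₐ[k] R') (x y : R) :
    φ (sideMul k s R x y) = sideMul k s R' (φ x) (φ y) := by
  cases s <;> simp [sideMul]

theorem sideMul_tmul {A : Type*} [Ring A] [Algebra k A] (s : Bool) (a a' : A) (h h' : H) :
    sideMul k s (A ⊗[k] H) (a ⊗ₜ h) (a' ⊗ₜ h') =
      sideMul k s A a a' ⊗ₜ[k] sideMul k s H h h' := by
  cases s <;> simp [sideMul]

/-- The map `v ↦ ∑ X(v₀) T(v₁)` (for `s = true`) or `v ↦ ∑ T(v₁) X(v₀)` (for `s = false`), where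
`δ v = ∑ v₀ ⊗ v₁`. -/
def act (s : Bool) (δ : V →ₗ[k] V ⊗[k] H) (X : V →ₗ[k] R) (T : H →ₗ[k] R) : V →ₗ[k] R :=
  TensorProduct.lift (sideMul k s R) ∘ₗ TensorProduct.map X T ∘ₗ δ

/-- The unit `h ↦ ε(h) 1` of the convolution. -/
def counitOne (k H R : Type*) [Field k] [Ring H] [HopfAlgebra k H] [Ring R] [Algebra k R] :
    H →ₗ[k] R :=
  Algebra.linearMap k R ∘ₗ Coalgebra.counit (R := k)

/-- Coassociativity of `δ` moves the bracket. With `δ` the coaction on `P` this composes operators,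
and with `δ` the coproduct it is associativity of convolution. -/
theorem act_assoc (s : Bool) (δ : V →ₗ[k] V ⊗[k] H)
    (hδ : (TensorProduct.assoc k V H H).toLinearMap ∘ₗ δ.rTensor H ∘ₗ δ =
      (Coalgebra.comul (R := k)).lTensor V ∘ₗ δ)
    (X : V →ₗ[k] R) (T U : H →ₗ[k] R) :
    act s δ (act s δ X T) U = act s δ X (act s (Coalgebra.comul (R := k)) T U) := by
  have key : TensorProduct.lift (sideMul k s R) ∘ₗ
        TensorProduct.map (TensorProduct.lift (sideMul k s R) ∘ₗ TensorProduct.map X T) U =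
      TensorProduct.lift (sideMul k s R) ∘ₗ
        TensorProduct.map X (TensorProduct.lift (sideMul k s R) ∘ₗ TensorProduct.map T U) ∘ₗ
        (TensorProduct.assoc k V H H).toLinearMap := by
    ext x y z
    simp [sideMul_assoc]
  ext f
  have h1 := LinearMap.congr_fun key (δ.rTensor H (δ f))
  have h2 := LinearMap.congr_fun hδ f
  simp only [LinearMap.comp_apply] at h1 h2
  rw [h2] at h1
  simp only [act, LinearMap.comp_apply]
  rw [LinearMap.rTensor, ← LinearMap.comp_apply (TensorProduct.map _ U), ← TensorProduct.map_comp,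
    LinearMap.lTensor, ← LinearMap.comp_apply (TensorProduct.map X _), ← TensorProduct.map_comp]
    at h1
  exact h1

theorem act_comul_assoc (s : Bool) (X T U : H →ₗ[k] R) :
    act s (Coalgebra.comul (R := k)) (act s (Coalgebra.comul (R := k)) X T) U =
      act s (Coalgebra.comul (R := k)) X (act s (Coalgebra.comul (R := k)) T U) :=
  act_assoc s _ Coalgebra.coassoc X T U

theorem counitOne_act (s : Bool) (T : H →ₗ[k] R) :
    act s (Coalgebra.comul (R := k)) (counitOne k H R) T = T := by
  have key : TensorProduct.lift (sideMul k s R) ∘ₗ TensorProduct.map (counitOne k H R) T =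
      T ∘ₗ (TensorProduct.lid k H).toLinearMap ∘ₗ
      (Coalgebra.counit (R := k) (A := H)).rTensor H := by
    ext v h
    simp [counitOne, Algebra.algebraMap_eq_smul_one, sideMul_one_left]
  rw [act, ← LinearMap.comp_assoc, key]
  ext h
  simp

theorem map_act (s : Bool) (φ : R →ₐ[k] R') (δ : V →ₗ[k] V ⊗[k] H) (X : V →ₗ[k] R)
    (T : H →ₗ[k] R) :
    φ.toLinearMap ∘ₗ act s δ X T = act s δ (φ.toLinearMap ∘ₗ X) (φ.toLinearMap ∘ₗ T) := by
  have key : φ.toLinearMap ∘ₗ TensorProduct.lift (sideMul k s R) ∘ₗ TensorProduct.map X T =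
      TensorProduct.lift (sideMul k s R') ∘ₗ
        TensorProduct.map (φ.toLinearMap ∘ₗ X) (φ.toLinearMap ∘ₗ T) := by
    ext v h
    simp [map_sideMul]
  exact congrArg (· ∘ₗ δ) key

/-- Naturality of `act` in the comodule. -/
theorem act_comp (s : Bool) (δ : V →ₗ[k] V ⊗[k] H) (δ' : W →ₗ[k] W ⊗[k] H) (χ : V →ₗ[k] W)
    (hχ : χ.rTensor H ∘ₗ δ = δ' ∘ₗ χ) (X : W →ₗ[k] R) (T : H →ₗ[k] R) :
    act s δ (X ∘ₗ χ) T = act s δ' X T ∘ₗ χ := by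
  have h : TensorProduct.map (X ∘ₗ χ) T = TensorProduct.map X T ∘ₗ χ.rTensor H := by ext; rfl
  rw [act, act, h, LinearMap.comp_assoc, LinearMap.comp_assoc, LinearMap.comp_assoc, ← hχ]

theorem act_sideMul_comp (s : Bool) (δ : V →ₗ[k] V ⊗[k] H) (X : V →ₗ[k] R) (T : H →ₗ[k] R)
    (y : R) : act s δ (sideMul k s R y ∘ₗ X) T = sideMul k s R y ∘ₗ act s δ X T := by
  have h : TensorProduct.lift (sideMul k s R) ∘ₗ TensorProduct.map (sideMul k s R y ∘ₗ X) T =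
      sideMul k s R y ∘ₗ TensorProduct.lift (sideMul k s R) ∘ₗ TensorProduct.map X T := by
    ext; simp [sideMul_assoc]
  exact congrArg (· ∘ₗ δ) h

theorem act_sub (s : Bool) (δ : V →ₗ[k] V ⊗[k] H) (X : V →ₗ[k] R) (T U : H →ₗ[k] R) :
    act s δ X (T - U) = act s δ X T - act s δ X U := by
  have h : TensorProduct.map X (T - U) = TensorProduct.map X T - TensorProduct.map X U := by
    ext; simp [TensorProduct.tmul_sub]
  rw [act, h, LinearMap.sub_comp, LinearMap.comp_sub]
  rfl

theorem act_mem_of_forall (s : Bool) (δ : V →ₗ[k] V ⊗[k] H) (X : V →ₗ[k] R) (T : H →ₗ[k] R)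
    (L : Submodule k R) (hL : ∀ v h, sideMul k s R (X v) (T h) ∈ L) (v : V) : act s δ X T v ∈ L := by
  rw [act, LinearMap.comp_apply, LinearMap.comp_apply]
  induction δ v with
  | zero => simp
  | add a b ha hb => rw [map_add, map_add]; exact add_mem ha hb
  | tmul a b => simpa using hL a b

/-- An antipode for the convolution on the given side. -/
def IsSideAntipode (s : Bool) (A : H →ₗ[k] H) : Prop :=
  act s (Coalgebra.comul (R := k)) LinearMap.id A = counitOne k H H ∧
    act s (Coalgebra.comul (R := k)) A LinearMap.id = counitOne k H H

theorem act_false (δ : V →ₗ[k] V ⊗[k] H) (X : V →ₗ[k] R) (T : H →ₗ[k] R) (v : V) :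
    act false δ X T v =
      LinearMap.mul' k R (TensorProduct.comm k R R (TensorProduct.map X T (δ v))) := by
  rw [act, LinearMap.comp_apply, LinearMap.comp_apply]
  induction TensorProduct.map X T (δ v) with
  | zero => simp
  | add a b ha hb => simp only [map_add, ha, hb]
  | tmul a b => simp [sideMul]

theorem twistedConv_eq_act (a b : H →ₗ[k] R) :
    twistedConv a b = act false (Coalgebra.comul (R := k)) b a := by
  have key : LinearMap.mul' k R ∘ₗ TensorProduct.map a b ∘ₗ
      (TensorProduct.comm k H H).toLinearMap = TensorProduct.lift (sideMul k false R) ∘ₗ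
        TensorProduct.map b a := by
    ext; simp [sideMul]
  exact congrArg (· ∘ₗ Coalgebra.comul (R := k)) key

theorem isSideAntipode_true : IsSideAntipode true (HopfAlgebra.antipode k : H →ₗ[k] H) := by
  constructor
  · ext h; exact HopfAlgebra.mul_antipode_lTensor_comul_apply h
  · ext h; exact HopfAlgebra.mul_antipode_rTensor_comul_apply h

/-- The inverse of the antipode works. The antipode is injective and reverses products, so applying
it to `∑ S⁻¹(h₂) h₁` gives `∑ S(h₁) h₂`, and the ordinary antipode identities take over. -/
theorem exists_isSideAntipode_false
    (hS : Function.Bijective (HopfAlgebra.antipode k : H →ₗ[k] H)) :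
    ∃ A : H →ₗ[k] H, IsSideAntipode false A := by
  let S := LinearEquiv.ofBijective (HopfAlgebra.antipode k : H →ₗ[k] H) hS
  have hSS : ∀ h, HopfAlgebra.antipode k (S.symm h) = h := S.apply_symm_apply
  have h0 : ∀ h, HopfAlgebra.antipode k (counitOne k H H h) = counitOne k H H h := by
    intro h
    simp [counitOne, Algebra.algebraMap_eq_smul_one]
  have h1 : HopfAlgebra.antipode k ∘ₗ TensorProduct.lift (sideMul k false H) ∘ₗ
      TensorProduct.map LinearMap.id S.symm.toLinearMap = TensorProduct.lift (sideMul k true H) ∘ₗ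
      TensorProduct.map (HopfAlgebra.antipode k : H →ₗ[k] H) LinearMap.id := by
    ext a b
    simp [sideMul, HopfAlgebra.antipode_mul_antidistrib, hSS]
  have h2 : HopfAlgebra.antipode k ∘ₗ TensorProduct.lift (sideMul k false H) ∘ₗ
      TensorProduct.map S.symm.toLinearMap LinearMap.id = TensorProduct.lift (sideMul k true H) ∘ₗ
      TensorProduct.map LinearMap.id (HopfAlgebra.antipode k : H →ₗ[k] H) := by
    ext a b
    simp [sideMul, HopfAlgebra.antipode_mul_antidistrib, hSS]
  refine ⟨S.symm.toLinearMap, ?_, ?_⟩ <;> ext h <;> apply hS.1 <;> rw [h0]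
  · rw [← isSideAntipode_true.2]
    exact LinearMap.congr_fun h1 _
  · rw [← isSideAntipode_true.1]
    exact LinearMap.congr_fun h2 _

theorem trivCoact_mk (V : Type*) [AddCommGroup V] [Module k V] (v : V) :
    (TensorProduct.mk k V H v).rTensor H ∘ₗ Coalgebra.comul (R := k) =
      trivCoact k H V ∘ₗ TensorProduct.mk k V H v := by
  ext h
  simp only [trivCoact, LinearMap.comp_apply, TensorProduct.mk_apply, LinearMap.lTensor_tmul]
  induction Coalgebra.comul (R := k) h with
  | zero => simp
  | add a b ha hb => simp only [map_add, TensorProduct.tmul_add, ha, hb]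
  | tmul a b => rfl

/-- Convolution inverses: `φ ∘ A` is inverse to `φ` for multiplicative `φ`. -/
theorem IsSideAntipode.comp {s : Bool} {A : H →ₗ[k] H} (hA : IsSideAntipode s A)
    (φ : H →ₐ[k] R) :
    act s (Coalgebra.comul (R := k)) φ.toLinearMap (φ.toLinearMap ∘ₗ A) = counitOne k H R ∧
      act s (Coalgebra.comul (R := k)) (φ.toLinearMap ∘ₗ A) φ.toLinearMap = counitOne k H R := by
  have h : φ.toLinearMap ∘ₗ counitOne k H H = counitOne k H R := by
    ext; simp [counitOne]
  rw [← h]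
  constructor
  · rw [← hA.1, map_act]; rfl
  · rw [← hA.2, map_act]; rfl

end Sided

/-! ### Solving `F f = ∑ f₀ T(f₁)` on a locally trivial bundle. -/

section Bundles

variable {k : Type*} [Field k] {B H P : Type*} [Ring B] [Algebra k B] [Ring H] [HopfAlgebra k H]
  [Ring P] [Algebra k P] {I : Type*} {Bi : I → Type*} [∀ i, Ring (Bi i)] [∀ i, Algebra k (Bi i)]
  (Q : Bundle k B H P Bi)

/-- Only a linear lift of `h ↦ 1 ⊗ h` is needed. It exists because a surjection of vector spaces
splits, and no multiplicativity is asked of it. -/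
theorem Bundle.exists_section (i : I) :
    ∃ σ : H →ₗ[k] P, (Q.χ i).toLinearMap ∘ₗ σ = TensorProduct.mk k (Bi i) H 1 := by
  obtain ⟨τ, hτ⟩ := LinearMap.exists_rightInverse_of_surjective (Q.χ i).toLinearMap
    (LinearMap.range_eq_top.2 (Q.χ_surjective i))
  exact ⟨τ ∘ₗ TensorProduct.mk k (Bi i) H 1, by rw [← LinearMap.comp_assoc, hτ, LinearMap.id_comp]⟩

variable {M : Type*} [Ring M] [Algebra k M] {N : I → Type*} [∀ i, Ring (N i)]
  [∀ i, Algebra k (N i)] (Ψ : P →ₐ[k] M) (ev : ∀ i, M →ₐ[k] N i) (ψ : ∀ i, Bi i ⊗[k] H →ₐ[k] N i)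

/-- `Ψ` on the total space, `ψ i` on the trivializations and the projections `ev i` commute. -/
def IsLocalization : Prop :=
  ∀ i, (ev i).toLinearMap ∘ₗ Ψ.toLinearMap = (ψ i).toLinearMap ∘ₗ (Q.χ i).toLinearMap

variable {Q Ψ ev ψ}

/-- Since the trivializations are colinear, the `i`-th component of the operator depends only on
`χ_i f` and on the `i`-th component of `T`. -/
theorem IsLocalization.ev_act (hψ : IsLocalization Q Ψ ev ψ) (s : Bool) (i : I) (T : H →ₗ[k] M) :
    (ev i).toLinearMap ∘ₗ act s Q.coact.toLinearMap Ψ.toLinearMap T =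
      act s (trivCoact k H (Bi i)) (ψ i).toLinearMap ((ev i).toLinearMap ∘ₗ T) ∘ₗ
        (Q.χ i).toLinearMap := by
  rw [map_act, hψ i, act_comp s _ _ _ (Q.χ_coact i)]

/-- For fixed `a` the map `h ↦ a ⊗ h` is colinear, so on the slice `a ⊗ H` the operator becomes a
convolution on `H`, which the antipode can invert. -/
theorem act_trivCoact_mk {A : Type*} [Ring A] [Algebra k A] (s : Bool) (ψ : A ⊗[k] H →ₗ[k] M)
    (T : H →ₗ[k] M) (a : A) :
    act s (trivCoact k H A) ψ T ∘ₗ TensorProduct.mk k A H a =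
      act s (Coalgebra.comul (R := k)) (ψ ∘ₗ TensorProduct.mk k A H a) T :=
  (act_comp s _ _ _ (trivCoact_mk A a) ψ T).symm

/-- The equation `F f = ∑ f₀ T(f₁)` can be solved for `T` modulo submodules containing the kernel of
one of the projections. -/
theorem IsLocalization.mem_of_act_mem (hψ : IsLocalization Q Ψ ev ψ) {s : Bool} {A : H →ₗ[k] H}
    (hA : IsSideAntipode s A) (j : I) (L : Submodule k M)
    (hL : ∀ f, ∀ x ∈ L, sideMul k s M (Ψ f) x ∈ L) (hker : ∀ x, ev j x = 0 → x ∈ L)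
    (T : H →ₗ[k] M) (hT : ∀ f, act s Q.coact.toLinearMap Ψ.toLinearMap T f ∈ L) (h : H) :
    T h ∈ L := by
  obtain ⟨σ, hσ⟩ := Q.exists_section j
  let φ : H →ₐ[k] N j := (ψ j).comp Algebra.TensorProduct.includeRight
  have hφ : (ψ j).toLinearMap ∘ₗ TensorProduct.mk k (Bi j) H 1 = φ.toLinearMap := rfl
  have hφσ : (ev j).toLinearMap ∘ₗ Ψ.toLinearMap ∘ₗ σ = φ.toLinearMap := by
    rw [← LinearMap.comp_assoc, hψ j, LinearMap.comp_assoc, hσ, hφ]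
  -- The antipode inversion `U(h) = ∑ Ψ(σ(A h₁)) F(σ(h₂))`, with `F f = ∑ f₀ T(f₁)`. It lies in `L`
  -- because every value of `F` does, and it differs from `T` only by an element of the kernel of
  -- `ev j`.
  let U : H →ₗ[k] M := act s (Coalgebra.comul (R := k)) (Ψ.toLinearMap ∘ₗ σ ∘ₗ A)
    (act s Q.coact.toLinearMap Ψ.toLinearMap T ∘ₗ σ)
  have hU : U h ∈ L := act_mem_of_forall s _ _ _ L (fun v w => hL _ _ (hT _)) h
  have h1 : (ev j).toLinearMap ∘ₗ U = (ev j).toLinearMap ∘ₗ T := by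
    have h2 : (ev j).toLinearMap ∘ₗ act s Q.coact.toLinearMap Ψ.toLinearMap T ∘ₗ σ =
        act s (Coalgebra.comul (R := k)) φ.toLinearMap ((ev j).toLinearMap ∘ₗ T) := by
      rw [← LinearMap.comp_assoc, hψ.ev_act, LinearMap.comp_assoc, hσ, act_trivCoact_mk, hφ]
    have h3 : (ev j).toLinearMap ∘ₗ Ψ.toLinearMap ∘ₗ σ ∘ₗ A = φ.toLinearMap ∘ₗ A := by
      rw [← hφσ]; rfl
    rw [map_act, h2, h3, ← act_comul_assoc, (hA.comp φ).2, counitOne_act]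
  have h4 : T h - U h ∈ L := hker _ (by
    rw [map_sub]; exact sub_eq_zero.2 (LinearMap.congr_fun h1 h).symm)
  simpa using add_mem h4 hU

/-- `T - U` induces the zero operator, so by `mem_of_act_mem` with `L` the kernel of `ev i` its
values have vanishing `i`-th component for every `i`. -/
theorem IsLocalization.act_injective (hψ : IsLocalization Q Ψ ev ψ)
    (hev : ∀ m, (∀ i, ev i m = 0) → m = 0) {s : Bool} {A : H →ₗ[k] H}
    (hA : IsSideAntipode s A) (T U : H →ₗ[k] M)
    (hTU : act s Q.coact.toLinearMap Ψ.toLinearMap T =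
      act s Q.coact.toLinearMap Ψ.toLinearMap U) : T = U := by
  ext h
  rw [← sub_eq_zero, ← LinearMap.sub_apply]
  refine hev _ fun i => ?_
  refine hψ.mem_of_act_mem hA i (LinearMap.ker (ev i).toLinearMap) ?_ (fun x hx => hx) (T - U) ?_ h
  · intro f x hx
    rw [LinearMap.mem_ker, AlgHom.toLinearMap_apply] at hx ⊢
    rw [map_sideMul, hx, map_zero]
  · intro f
    rw [act_sub, hTU, sub_self]
    exact zero_mem _

/-- Every local operator on `P` that is linear over the base has locally the form
`f ↦ ∑ f₀ T(f₁)`. -/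
theorem IsLocalization.exists_local_act (hψ : IsLocalization Q Ψ ev ψ) {s : Bool} {A : H →ₗ[k] H}
    (hA : IsSideAntipode s A) (F : P →ₗ[k] M)
    (hFB : ∀ b f, F (sideMul k s P (Q.ι b) f) = sideMul k s M (Ψ (Q.ι b)) (F f)) (i : I)
    (hF : ∀ f, Q.χ i f = 0 → ev i (F f) = 0) :
    ∃ T : H →ₗ[k] M, (ev i).toLinearMap ∘ₗ F =
      (ev i).toLinearMap ∘ₗ act s Q.coact.toLinearMap Ψ.toLinearMap T := by
  obtain ⟨σ, hσ⟩ := Q.exists_section i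
  let φ : H →ₐ[k] N i := (ψ i).comp Algebra.TensorProduct.includeRight
  have hφ : (ψ i).toLinearMap ∘ₗ TensorProduct.mk k (Bi i) H 1 = φ.toLinearMap := rfl
  have hφσ : (ev i).toLinearMap ∘ₗ Ψ.toLinearMap ∘ₗ σ = φ.toLinearMap := by
    rw [← LinearMap.comp_assoc, hψ i, LinearMap.comp_assoc, hσ, hφ]
  -- The antipode inversion again, now used as a definition. It is built so that the required
  -- formula holds on the lifts `σ h` of `1 ⊗ h`.
  let T : H →ₗ[k] M := act s (Coalgebra.comul (R := k)) (Ψ.toLinearMap ∘ₗ σ ∘ₗ A) (F ∘ₗ σ)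
  refine ⟨T, ?_⟩
  have h3 : (ev i).toLinearMap ∘ₗ Ψ.toLinearMap ∘ₗ σ ∘ₗ A = φ.toLinearMap ∘ₗ A := by
    rw [← hφσ]; rfl
  have hT : act s (Coalgebra.comul (R := k)) φ.toLinearMap ((ev i).toLinearMap ∘ₗ T) =
      (ev i).toLinearMap ∘ₗ F ∘ₗ σ := by
    rw [map_act, h3, ← act_comul_assoc, (hA.comp φ).1, counitOne_act]
  -- Locality: the `i`-th component of `F f` depends only on `χ_i f`, so any convenient preimage may
  -- be used to test the formula.
  have hdep : ∀ f f', Q.χ i f = Q.χ i f' → ev i (F f) = ev i (F f') := by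
    intro f f' h
    rw [← sub_eq_zero, ← map_sub, ← map_sub]
    exact hF _ (by rw [map_sub, h, sub_self])
  have hx : ∀ x : Bi i ⊗[k] H, ∃ f, Q.χ i f = x ∧ ev i (F f) =
      act s (trivCoact k H (Bi i)) (ψ i).toLinearMap ((ev i).toLinearMap ∘ₗ T) x := by
    intro x
    induction x with
    | zero => exact ⟨0, by simp, by simp⟩
    | add x y hx hy =>
      obtain ⟨f, hf, hf'⟩ := hx
      obtain ⟨g, hg, hg'⟩ := hy
      exact ⟨f + g, by rw [map_add, hf, hg], by simp only [map_add, hf', hg']⟩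
    | tmul a h =>
      obtain ⟨b, rfl⟩ := Q.π_surjective i a
      have hσh : Q.χ i (σ h) = 1 ⊗ₜ h := LinearMap.congr_fun hσ h
      -- `a ⊗ h` is lifted as a base element times `σ h`, so that base linearity of `F` reduces the
      -- formula to `1 ⊗ h`.
      refine ⟨sideMul k s P (Q.ι b) (σ h), ?_, ?_⟩
      · rw [map_sideMul, Q.χ_ι, hσh, sideMul_tmul, sideMul_one_left, sideMul_one_right]
      · have h1 := LinearMap.congr_fun (act_trivCoact_mk s (ψ i).toLinearMap
          ((ev i).toLinearMap ∘ₗ T) (Q.π i b)) h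
        have h2 : (ψ i).toLinearMap ∘ₗ TensorProduct.mk k (Bi i) H (Q.π i b) =
            sideMul k s _ (ψ i (Q.π i b ⊗ₜ 1)) ∘ₗ φ.toLinearMap := by
          ext g
          have : φ g = ψ i (1 ⊗ₜ g) := rfl
          simp only [LinearMap.comp_apply, AlgHom.toLinearMap_apply, this, ← map_sideMul,
            sideMul_tmul, sideMul_one_left, sideMul_one_right, TensorProduct.mk_apply]
        rw [h2, act_sideMul_comp, hT] at h1
        have h5 : ev i (Ψ (Q.ι b)) = ψ i (Q.π i b ⊗ₜ 1) := by
          rw [← Q.χ_ι]; exact LinearMap.congr_fun (hψ i) (Q.ι b)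
        rw [hFB, map_sideMul, h5]
        exact h1.symm
  rw [hψ.ev_act]
  ext f
  obtain ⟨f', h1, h2⟩ := hx (Q.χ i f)
  exact (hdep f f' h1.symm).trans h2

/-- Every local operator on `P` that is linear over the base has the form `f ↦ ∑ f₀ T(f₁)`. -/
theorem IsLocalization.exists_act (hψ : IsLocalization Q Ψ ev ψ)
    (hev : ∀ m, (∀ i, ev i m = 0) → m = 0) {s : Bool} {A : H →ₗ[k] H}
    (hA : IsSideAntipode s A) (L : I → I → Submodule k M)
    (hL : ∀ i j f, ∀ x ∈ L i j, sideMul k s M (Ψ f) x ∈ L i j)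
    (hker : ∀ i j x, ev i x = 0 → x ∈ L i j) (hker' : ∀ i j x, ev j x = 0 → x ∈ L i j)
    (hglue : ∀ m : I → M, (∀ i j, m i - m j ∈ L i j) → ∃ x, ∀ i, ev i x = ev i (m i))
    (F : P →ₗ[k] M)
    (hFB : ∀ b f, F (sideMul k s P (Q.ι b) f) = sideMul k s M (Ψ (Q.ι b)) (F f))
    (hF : ∀ i f, Q.χ i f = 0 → ev i (F f) = 0) :
    ∃ T : H →ₗ[k] M, F = act s Q.coact.toLinearMap Ψ.toLinearMap T := by
  have hinj : ∀ x y, (∀ i, ev i x = ev i y) → x = y := fun x y h =>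
    sub_eq_zero.1 (hev _ fun i => by rw [map_sub, h, sub_self])
  choose T hT using fun i => hψ.exists_local_act hA F hFB i (hF i)
  -- On the overlap `T i` and `T j` both represent `F` modulo `L i j`, so their difference acts into
  -- `L i j` and hence takes values in it.
  have hTL : ∀ h i j, T i h - T j h ∈ L i j := by
    intro h i j
    rw [← LinearMap.sub_apply]
    refine hψ.mem_of_act_mem hA j (L i j) (hL i j) (hker' i j) _ (fun f => ?_) h
    rw [act_sub, LinearMap.sub_apply]
    have h1 := hker i j (act s Q.coact.toLinearMap Ψ.toLinearMap (T i) f - F f) (by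
      rw [map_sub]; exact sub_eq_zero.2 (LinearMap.congr_fun (hT i) f).symm)
    have h2 := hker' i j (F f - act s Q.coact.toLinearMap Ψ.toLinearMap (T j) f) (by
      rw [map_sub]; exact sub_eq_zero.2 (LinearMap.congr_fun (hT j) f))
    simpa using add_mem h1 h2
  choose G hG using fun h => hglue (fun i => T i h) (hTL h)
  -- The values are glued one `h` at a time. Linearity follows because an element of `M` is
  -- determined by its components.
  let G' : H →ₗ[k] M :=
    { toFun := G
      map_add' := fun x y => hinj _ _ fun i => by simp only [map_add, hG]
      map_smul' := fun r x => hinj _ _ fun i => by simp [hG] }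
  have hG' : ∀ i, (ev i).toLinearMap ∘ₗ G' = (ev i).toLinearMap ∘ₗ T i := fun i =>
    LinearMap.ext fun h => hG h i
  refine ⟨G', LinearMap.ext fun f => hinj _ _ fun i => ?_⟩
  refine (LinearMap.congr_fun (hT i) f).trans ?_
  rw [hψ.ev_act, ← hG', ← hψ.ev_act]
  rfl

end Bundles

/-! ### Gauge transformations and their maps `g_α`. -/

section Gauge

variable {k : Type*} [Field k] {B H P : Type*} [Ring B] [Algebra k B] [Ring H] [HopfAlgebra k H]
  [Ring P] [Algebra k P] {I : Type*} {Bi : I → Type*} [∀ i, Ring (Bi i)] [∀ i, Algebra k (Bi i)]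
  {Q : Bundle k B H P Bi}

/-- Gauge transformations of the trivial bundle `A ⊗ H` on the given side. -/
structure IsTrivGauge (s : Bool) {A : Type*} [Ring A] [Algebra k A]
    (α : (A ⊗[k] H) ≃ₗ[k] (A ⊗[k] H)) : Prop where
  module : ∀ (a : A) (x : A ⊗[k] H),
    α (sideMul k s _ (a ⊗ₜ 1) x) = sideMul k s _ (a ⊗ₜ 1) (α x)
  coact : α.toLinearMap.rTensor H ∘ₗ trivCoact k H A = trivCoact k H A ∘ₗ α.toLinearMap
  base : ∀ a : A, α (a ⊗ₜ 1) = a ⊗ₜ 1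

/-- Gauge transformations of a locally trivial bundle on the given side, with their local
representatives. -/
structure IsGauge (s : Bool) (Q : Bundle k B H P Bi) (α : P ≃ₗ[k] P)
    (αi : ∀ i, (Bi i ⊗[k] H) ≃ₗ[k] (Bi i ⊗[k] H)) : Prop where
  module : ∀ (b : B) (f : P), α (sideMul k s P (Q.ι b) f) = sideMul k s P (Q.ι b) (α f)
  triv : ∀ i, IsTrivGauge s (αi i)
  local_eq : ∀ i f, Q.χ i (α f) = αi i (Q.χ i f)

theorem IsLeftGauge.exists_isGauge {α : P ≃ₗ[k] P} (hα : IsLeftGauge Q α) :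
    ∃ αi, IsGauge true Q α αi := by
  obtain ⟨αi, h⟩ := hα.local_triv
  exact ⟨αi, hα.module, fun i => ⟨(h i).1.module, (h i).1.coact, (h i).1.base⟩, fun i => (h i).2⟩

theorem IsRightGauge.exists_isGauge {α : P ≃ₗ[k] P} (hα : IsRightGauge Q α) :
    ∃ αi, IsGauge false Q α αi := by
  obtain ⟨αi, h⟩ := hα.local_triv
  exact ⟨αi, hα.module, fun i => ⟨(h i).1.module, (h i).1.coact, (h i).1.base⟩, fun i => (h i).2⟩

theorem IsTrivGauge.symm {s : Bool} {A : Type*} [Ring A] [Algebra k A]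
    {α : (A ⊗[k] H) ≃ₗ[k] (A ⊗[k] H)} (hα : IsTrivGauge s α) : IsTrivGauge s α.symm where
  module a x := by rw [LinearEquiv.symm_apply_eq, hα.module, α.apply_symm_apply]
  coact := by
    have h := congrArg (fun t => α.symm.toLinearMap.rTensor H ∘ₗ t ∘ₗ α.symm.toLinearMap) hα.coact
    simp only [LinearMap.comp_assoc] at h
    rw [← LinearMap.comp_assoc, ← LinearMap.rTensor_comp] at h
    simpa using h.symm
  base a := by rw [LinearEquiv.symm_apply_eq, hα.base]

theorem IsGauge.symm {s : Bool} {α : P ≃ₗ[k] P} {αi : ∀ i, (Bi i ⊗[k] H) ≃ₗ[k] (Bi i ⊗[k] H)}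
    (hα : IsGauge s Q α αi) : IsGauge s Q α.symm fun i => (αi i).symm where
  module b f := by rw [LinearEquiv.symm_apply_eq, hα.module, α.apply_symm_apply]
  triv i := (hα.triv i).symm
  local_eq i f := by rw [LinearEquiv.eq_symm_apply, ← hα.local_eq, α.apply_symm_apply]

theorem isLocalization_total (Q : Bundle k B H P Bi) :
    IsLocalization Q (AlgHom.id k P) Q.χ fun _ => AlgHom.id k _ := fun _ => rfl

theorem Bundle.eq_zero_of_forall_χ (Q : Bundle k B H P Bi) (f : P) (hf : ∀ i, Q.χ i f = 0) :
    f = 0 := by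
  rw [← Ideal.mem_bot, ← Q.total_covering.1, Ideal.mem_iInf]
  exact hf

/-- The instance `M = P` of `exists_act`. The overlap subspaces are `ker χ_i + ker χ_j`, and gluing
is completeness of the covering of `P`. -/
theorem IsGauge.exists_map {s : Bool} {α : P ≃ₗ[k] P}
    {αi : ∀ i, (Bi i ⊗[k] H) ≃ₗ[k] (Bi i ⊗[k] H)} (hα : IsGauge s Q α αi) {A : H →ₗ[k] H}
    (hA : IsSideAntipode s A) :
    ∃ g : H →ₗ[k] P, α.toLinearMap = act s Q.coact.toLinearMap LinearMap.id g := by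
  refine (isLocalization_total Q).exists_act Q.eq_zero_of_forall_χ hA
    (fun i j => LinearMap.ker (Q.χ i).toLinearMap ⊔ LinearMap.ker (Q.χ j).toLinearMap)
    ?_ (fun i j x hx => Submodule.mem_sup_left hx) (fun i j x hx => Submodule.mem_sup_right hx)
    ?_ α.toLinearMap hα.module ?_
  · intro i j f x hx
    obtain ⟨u, hu, v, hv, rfl⟩ := Submodule.mem_sup.1 hx
    rw [map_add]
    refine Submodule.add_mem_sup ?_ ?_
    · rw [LinearMap.mem_ker, AlgHom.toLinearMap_apply] at hu ⊢
      rw [map_sideMul, hu, map_zero]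
    · rw [LinearMap.mem_ker, AlgHom.toLinearMap_apply] at hv ⊢
      rw [map_sideMul, hv, map_zero]
  · intro m hm
    obtain ⟨r, hr⟩ := Q.total_covering.2 m fun i j => by
      obtain ⟨u, hu, v, hv, huv⟩ := Submodule.mem_sup.1 (hm i j)
      rw [← huv]
      exact Submodule.add_mem_sup hu hv
    exact ⟨r, fun i => sub_eq_zero.1 (by rw [← map_sub]; exact hr i)⟩
  · intro i f hf
    exact (hα.local_eq i f).trans (by rw [hf, map_zero])

theorem gaugeMap_unique {s : Bool} {A : H →ₗ[k] H} (hA : IsSideAntipode s A) {g g' : H →ₗ[k] P}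
    (h : act s Q.coact.toLinearMap LinearMap.id g = act s Q.coact.toLinearMap LinearMap.id g') :
    g = g' :=
  (isLocalization_total Q).act_injective Q.eq_zero_of_forall_χ hA g g' h

theorem isLeftGaugeMap_iff (α : P ≃ₗ[k] P) (g : H →ₗ[k] P) :
    IsLeftGaugeMap Q α g ↔ α.toLinearMap = act true Q.coact.toLinearMap LinearMap.id g :=
  ⟨fun h => LinearMap.ext h, fun h f => LinearMap.congr_fun h f⟩

theorem isRightGaugeMap_iff (α : P ≃ₗ[k] P) (g : H →ₗ[k] P) :
    IsRightGaugeMap Q α g ↔ α.toLinearMap = act false Q.coact.toLinearMap LinearMap.id g :=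
  ⟨fun h => LinearMap.ext fun f => (h f).trans (act_false Q.coact.toLinearMap LinearMap.id g f).symm,
    fun h f => (LinearMap.congr_fun h f).trans (act_false Q.coact.toLinearMap LinearMap.id g f)⟩

/-- A gauge transformation is determined locally by its map `g`. -/
theorem IsGauge.triv_eq_act {s : Bool} {α : P ≃ₗ[k] P}
    {αi : ∀ i, (Bi i ⊗[k] H) ≃ₗ[k] (Bi i ⊗[k] H)} (hα : IsGauge s Q α αi) {g : H →ₗ[k] P}
    (hg : α.toLinearMap = act s Q.coact.toLinearMap LinearMap.id g) (i : I) :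
    (αi i).toLinearMap = act s (trivCoact k H (Bi i)) LinearMap.id ((Q.χ i).toLinearMap ∘ₗ g) := by
  ext1
  ext a h
  have h1 := (isLocalization_total Q).ev_act s i g
  obtain ⟨f, hf⟩ := Q.χ_surjective i (a ⊗ₜ h)
  have h2 := LinearMap.congr_fun h1 f
  have h3 := LinearMap.congr_fun hg f
  simp only [LinearMap.comp_apply, AlgHom.toLinearMap_apply, AlgHom.toLinearMap_id] at h2
  rw [← h3, LinearEquiv.coe_coe, hα.local_eq, hf] at h2
  exact h2

end Gauge

/-! ### Extension of gauge transformations from `A ⊗ H` to `C ⊗ H`. -/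

section TrivialExtension

variable {k : Type*} [Field k] {H : Type*} [Ring H] [HopfAlgebra k H]
  {A : Type*} [Ring A] [Algebra k A] {C : Type*} [Ring C] [Algebra k C]

/-- Multiplication by `x ⊗ 1` on either side is colinear because `1` is multiplied into the first
leg of the coproduct only trivially. This makes operators of the form `act` linear over `C`. -/
theorem trivCoact_sideMul (s : Bool) (x : C) :
    (sideMul k s (C ⊗[k] H) (x ⊗ₜ 1)).rTensor H ∘ₗ trivCoact k H C =
      trivCoact k H C ∘ₗ sideMul k s (C ⊗[k] H) (x ⊗ₜ 1) := by
  ext1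
  ext c h
  have h1 : sideMul k s (C ⊗[k] H) (x ⊗ₜ 1) (c ⊗ₜ h) = sideMul k s C x c ⊗ₜ h := by
    rw [sideMul_tmul, sideMul_one_left]
  simp only [TensorProduct.AlgebraTensorModule.curry_apply, LinearMap.restrictScalars_self,
    TensorProduct.curry_apply, LinearMap.comp_apply, h1]
  simp only [trivCoact, LinearMap.comp_apply, LinearMap.lTensor_tmul, LinearEquiv.coe_coe]
  induction Coalgebra.comul (R := k) h with
  | zero => simp
  | add a b ha hb => simp only [map_add, TensorProduct.tmul_add, ha, hb]
  | tmul a b =>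
    simp only [TensorProduct.assoc_symm_tmul, LinearMap.rTensor_tmul, sideMul_tmul,
      sideMul_one_left]

theorem act_trivCoact_sideMul (s : Bool) (T : H →ₗ[k] C ⊗[k] H) (x : C) (c : C ⊗[k] H) :
    act s (trivCoact k H C) LinearMap.id T (sideMul k s _ (x ⊗ₜ 1) c) =
      sideMul k s _ (x ⊗ₜ 1) (act s (trivCoact k H C) LinearMap.id T c) := by
  have h := act_comp s _ _ _ (trivCoact_sideMul (k := k) (H := H) s x) LinearMap.id T
  rw [← LinearMap.comp_apply, ← h, LinearMap.id_comp, ← LinearMap.comp_id (sideMul k s _ _),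
    act_sideMul_comp]
  rfl

theorem tmul_eq_sideMul (s : Bool) (x : C) (h : H) :
    x ⊗ₜ[k] h = sideMul k s (C ⊗[k] H) (x ⊗ₜ 1) (1 ⊗ₜ h) := by
  rw [sideMul_tmul, sideMul_one_left, sideMul_one_right]

/-- On either side `C ⊗ H` is spanned by the `C`-multiples of the elements `1 ⊗ g`, and these come
from `A ⊗ H`. Identities for the extension thereby reduce to identities for `α`. -/
theorem linearMap_ext_sideMul {W : Type*} [AddCommMonoid W] [Module k W] (s : Bool)
    {φ ψ : C ⊗[k] H →ₗ[k] W}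
    (h : ∀ x : C, ∀ g : H, φ (sideMul k s _ (x ⊗ₜ 1) (1 ⊗ₜ g)) =
      ψ (sideMul k s _ (x ⊗ₜ 1) (1 ⊗ₜ g))) : φ = ψ := by
  ext1
  ext x g
  have := h x g
  simp only [← tmul_eq_sideMul] at this
  exact this

variable {s : Bool} (e : A →ₐ[k] C) {α : (A ⊗[k] H) ≃ₗ[k] (A ⊗[k] H)} {T : H →ₗ[k] A ⊗[k] H}

/-- The extension of scalars `A ⊗ H → C ⊗ H`. -/
abbrev scalarExt (k H : Type*) [Field k] [Ring H] [HopfAlgebra k H] {A : Type*} [Ring A]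
    [Algebra k A] {C : Type*} [Ring C] [Algebra k C] (e : A →ₐ[k] C) : A ⊗[k] H →ₐ[k] C ⊗[k] H :=
  Algebra.TensorProduct.map e (AlgHom.id k H)

/-- The extension of the map `x ↦ ∑ x₀ T(x₁)` on `A ⊗ H` to `C ⊗ H`. -/
def extendAct (s : Bool) (e : A →ₐ[k] C) (T : H →ₗ[k] A ⊗[k] H) : C ⊗[k] H →ₗ[k] C ⊗[k] H :=
  act s (trivCoact k H C) LinearMap.id ((scalarExt k H e).toLinearMap ∘ₗ T)

theorem scalarExt_coact :
    (scalarExt k H e).toLinearMap.rTensor H ∘ₗ trivCoact k H A =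
      trivCoact k H C ∘ₗ (scalarExt k H e).toLinearMap :=
  LinearMap.ext fun c => (DifferentialStructure.trivCoact_rTensor e.toLinearMap c).symm

theorem extendAct_scalarExt (hT : α.toLinearMap = act s (trivCoact k H A) LinearMap.id T)
    (x : A ⊗[k] H) : extendAct s e T (scalarExt k H e x) = scalarExt k H e (α x) := by
  have h1 : α x = act s (trivCoact k H A) LinearMap.id T x := LinearMap.congr_fun hT x
  have h := act_comp s _ _ _ (scalarExt_coact (H := H) e) LinearMap.id
    ((scalarExt k H e).toLinearMap ∘ₗ T)
  have h2 := map_act s (scalarExt k H e) (trivCoact k H A) LinearMap.id T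
  rw [h1]
  exact (LinearMap.congr_fun h x).symm.trans (LinearMap.congr_fun h2 x).symm

theorem extendAct_one_tmul (hT : α.toLinearMap = act s (trivCoact k H A) LinearMap.id T)
    (h : H) : extendAct s e T (1 ⊗ₜ h) = scalarExt k H e (α (1 ⊗ₜ h)) := by
  rw [← extendAct_scalarExt e hT]
  simp

theorem extendAct_sideMul (x : C) (c : C ⊗[k] H) :
    extendAct s e T (sideMul k s _ (x ⊗ₜ 1) c) = sideMul k s _ (x ⊗ₜ 1) (extendAct s e T c) :=
  act_trivCoact_sideMul s _ x c

theorem extendAct_symm (hT : α.toLinearMap = act s (trivCoact k H A) LinearMap.id T)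
    {T' : H →ₗ[k] A ⊗[k] H}
    (hT' : α.symm.toLinearMap = act s (trivCoact k H A) LinearMap.id T') (c : C ⊗[k] H) :
    extendAct s e T' (extendAct s e T c) = c := by
  suffices extendAct s e T' ∘ₗ extendAct s e T = LinearMap.id from LinearMap.congr_fun this c
  refine linearMap_ext_sideMul s fun x g => ?_
  rw [LinearMap.comp_apply, extendAct_sideMul, extendAct_sideMul, extendAct_one_tmul e hT,
    extendAct_scalarExt e hT', α.symm_apply_apply]
  simp

/-- Multiplication by `x ⊗ 1` is colinear and commutes with the extension, so it is enough to look
at `1 ⊗ g`. There colinearity of `α` is carried over by the colinear map `scalarExt`. -/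
theorem extendAct_coact (hα : IsTrivGauge s α)
    (hT : α.toLinearMap = act s (trivCoact k H A) LinearMap.id T) :
    (extendAct s e T).rTensor H ∘ₗ trivCoact k H C = trivCoact k H C ∘ₗ extendAct s e T := by
  refine linearMap_ext_sideMul s fun x g => ?_
  have h1 : ∀ c, trivCoact k H C (sideMul k s _ (x ⊗ₜ 1) c) =
      (sideMul k s (C ⊗[k] H) (x ⊗ₜ 1)).rTensor H (trivCoact k H C c) := fun c =>
    (LinearMap.congr_fun (trivCoact_sideMul s x) c).symm
  have h2 : extendAct s e T ∘ₗ sideMul k s _ (x ⊗ₜ 1) =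
      sideMul k s _ (x ⊗ₜ 1) ∘ₗ extendAct s e T := LinearMap.ext (extendAct_sideMul e x)
  rw [LinearMap.comp_apply, LinearMap.comp_apply, h1, ← LinearMap.comp_apply,
    ← LinearMap.rTensor_comp, h2, LinearMap.rTensor_comp, LinearMap.comp_apply, extendAct_sideMul,
    h1, extendAct_one_tmul e hT]
  congr 1
  have h3 : (1 : C) ⊗ₜ[k] g = scalarExt k H e (1 ⊗ₜ g) := by simp
  have h4 : extendAct s e T ∘ₗ (scalarExt k H e).toLinearMap =
      (scalarExt k H e).toLinearMap ∘ₗ α.toLinearMap := LinearMap.ext (extendAct_scalarExt e hT)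
  have h5 : ∀ y, trivCoact k H C (scalarExt k H e y) =
      (scalarExt k H e).toLinearMap.rTensor H (trivCoact k H A y) := fun y =>
    (LinearMap.congr_fun (scalarExt_coact e) y).symm
  rw [h3, h5, h5, ← LinearMap.comp_apply, ← LinearMap.rTensor_comp, h4, LinearMap.rTensor_comp,
    LinearMap.comp_apply]
  congr 1
  exact LinearMap.congr_fun hα.coact _

theorem extendAct_one (hα : IsTrivGauge s α)
    (hT : α.toLinearMap = act s (trivCoact k H A) LinearMap.id T) : extendAct s e T 1 = 1 := by
  rw [Algebra.TensorProduct.one_def, extendAct_one_tmul e hT, hα.base]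
  simp

theorem sideMul_tmul_mem {L : Submodule k C} (x : C)
    (hx : ∀ a : A, sideMul k s C x (e a) ∈ L) (y : A ⊗[k] H) :
    sideMul k s _ (x ⊗ₜ 1) (scalarExt k H e y) ∈ LinearMap.range (L.subtype.rTensor H) := by
  induction y with
  | zero => simp
  | add a b ha hb => rw [map_add, map_add]; exact add_mem ha hb
  | tmul a h =>
    rw [Algebra.TensorProduct.map_tmul, sideMul_tmul, sideMul_one_left]
    exact ⟨⟨_, hx a⟩ ⊗ₜ h, rfl⟩

/-- The image of `1 ⊗ h` has its first factors in `e(A)`, so `x ⊗ h` only has `x` multiplied by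
elements of `e(A)`. With `L` the forms of degree `n` and `e(A)` in degree zero, this says that
degree is preserved. -/
theorem extendAct_mem (hT : α.toLinearMap = act s (trivCoact k H A) LinearMap.id T)
    {L : Submodule k C} (hL : ∀ x ∈ L, ∀ a : A, sideMul k s C x (e a) ∈ L) (c : C ⊗[k] H)
    (hc : c ∈ LinearMap.range (L.subtype.rTensor H)) :
    extendAct s e T c ∈ LinearMap.range (L.subtype.rTensor H) := by
  obtain ⟨c, rfl⟩ := hc
  induction c with
  | zero => simp
  | add a b ha hb => rw [map_add, map_add]; exact add_mem ha hb
  | tmul x h =>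
    rw [LinearMap.rTensor_tmul, Submodule.subtype_apply, tmul_eq_sideMul s, extendAct_sideMul,
      extendAct_one_tmul e hT]
    exact sideMul_tmul_mem e _ (hL x x.2) _

end TrivialExtension
-- Horizontal forms: overlaps, gluing and the extension of gauge transformations.
namespace DifferentialStructure

variable {k : Type*} [Field k] {B H P : Type*} [Ring B] [Algebra k B] [Ring H] [HopfAlgebra k H]
  [Ring P] [Algebra k P] {I : Type*} {Bi : I → Type*} [∀ i, Ring (Bi i)] [∀ i, Algebra k (Bi i)]
  {Q : Bundle k B H P Bi} (S : DifferentialStructure Q)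

/-! ### The horizontal forms as a localized algebra -/

/-- The inclusion `Γ(B_i) ⊗ H → Γ(B_i) ⊗ Γ(H)` as a homomorphism of algebras. -/
def horInclHom (i : I) : (S.base i).Form ⊗[k] H →ₐ[k] S.LocForm i :=
  AlgHom.ofLinearMap (S.horIncl i) (S.horIncl_one i) fun x y => (S.horIncl_mul i x y).symm

theorem horInclHom_apply (i : I) (c : (S.base i).Form ⊗[k] H) :
    S.horInclHom i c = S.horIncl i c := rfl

/-- The projection of the horizontal forms to their `i`-th component. -/
def component (i : I) : S.hor →ₐ[k] S.LocForm i :=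
  (Pi.evalAlgHom k (fun i => S.LocForm i) i).comp S.hor.val

theorem component_apply (i : I) (γ : S.hor) : S.component i γ = (γ : S.LocForms) i := rfl

variable {S} in
theorem hor_ext {γ γ' : S.hor} (h : ∀ i, S.component i γ = S.component i γ') : γ = γ' :=
  Subtype.ext (funext h)

theorem eq_zero_of_forall_component (γ : S.hor) (h : ∀ i, S.component i γ = 0) : γ = 0 :=
  hor_ext fun i => by rw [h, map_zero]

theorem exists_component_eq (i : I) (γ : S.hor) : ∃ c, S.component i γ = S.horInclHom i c := by
  obtain ⟨c, hc⟩ := γ.2.2 i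
  exact ⟨c, hc.symm⟩

theorem component_ofTotal (i : I) (f : P) :
    S.component i (S.ofTotal f) = S.horInclHom i (scalarExt k H (S.base i).incl (Q.χ i f)) := rfl

theorem isLocalization_hor : IsLocalization Q S.ofTotal S.component
    fun i => (S.horInclHom i).comp (scalarExt k H (S.base i).incl) := fun _ => rfl

/-- The horizontal forms that vanish on the overlap of the `i`-th and the `j`-th trivialization. -/
def overlapKer (i j : I) : Submodule k S.hor :=
  ((LinearMap.ker (S.χForm j).toLinearMap).map (S.χForm i).toLinearMap).comap
    (S.component i).toLinearMap

theorem mem_overlapKer {i j : I} {γ : S.hor} : γ ∈ S.overlapKer i j ↔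
    ∃ a : S.totalForms, S.χForm j a = 0 ∧ S.χForm i a = S.component i γ := Iff.rfl

/-- The definition looks only at the `i`-th component. Compatibility of `γ` gives `a i - a j = u +
v` with `u`, `v` in the two kernels. The element `a i - c - u = a j + v - c` is then killed by `χ_i`
and represents the `j`-th component. -/
theorem overlapKer_symm {i j : I} {γ : S.hor} (hγ : γ ∈ S.overlapKer i j) :
    γ ∈ S.overlapKer j i := by
  obtain ⟨c, hcj, hci⟩ := S.mem_overlapKer.1 hγ
  obtain ⟨a, ha, ha'⟩ := γ.2.1
  obtain ⟨u, hu, v, hv, huv⟩ := Submodule.mem_sup.1 (ha' i j)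
  rw [RingHom.mem_ker] at hu hv
  refine S.mem_overlapKer.2 ⟨a i - c - u, ?_, ?_⟩
  · rw [map_sub, map_sub, hu, hci, ha, component_apply]
    simp
  · have h : a i - c - u = a j + v - c := by
      rw [sub_eq_iff_eq_add.1 huv.symm]
      abel
    rw [h, map_sub, map_add, hv, hcj, ha, component_apply]
    simp

theorem mem_overlapKer_left {i j : I} {γ : S.hor} (hγ : S.component i γ = 0) :
    γ ∈ S.overlapKer i j :=
  S.mem_overlapKer.2 ⟨0, map_zero _, by rw [hγ, map_zero]⟩

theorem sideMul_mem_overlapKer (s : Bool) (i j : I) (f : P) (γ : S.hor)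
    (hγ : γ ∈ S.overlapKer i j) : sideMul k s S.hor (S.ofTotal f) γ ∈ S.overlapKer i j := by
  obtain ⟨c, hcj, hci⟩ := S.mem_overlapKer.1 hγ
  let f' : S.totalForms := ⟨S.funLin f, Algebra.subset_adjoin (Or.inl ⟨f, rfl⟩)⟩
  refine S.mem_overlapKer.2 ⟨sideMul k s _ f' c, ?_, ?_⟩
  · rw [map_sideMul, hcj, map_zero]
  · rw [map_sideMul, map_sideMul, hci]
    rfl

/-- Compatibility in `Γ_c(P)` is tested in `Γ(P)`, not among horizontal forms, so representatives in
`Γ(P)` have to be compared. -/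
theorem exists_glue (m : I → S.hor) (hm : ∀ i j, m i - m j ∈ S.overlapKer i j) :
    ∃ γ : S.hor, ∀ i, S.component i γ = S.component i (m i) := by
  choose a ha ha' using fun i => (m i).2.1
  refine ⟨⟨fun i => S.component i (m i), ⟨fun i => a i i, fun i => ha i i, fun i j => ?_⟩,
    fun i => (m i).2.2 i⟩, fun i => rfl⟩
  obtain ⟨c, hci, hcj⟩ := S.mem_overlapKer.1 (S.overlapKer_symm (hm i j))
  -- The passage from `a i i` to `a j j` goes through `a i j`: the first difference is compatibility
  -- of `m i`, and this one is the overlap condition on `m i - m j`, up to `ker χ_j`.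
  have h1 : a i j - a j j ∈ RingHom.ker (S.χForm i) ⊔ RingHom.ker (S.χForm j) := by
    rw [← add_sub_cancel c (a i j - a j j)]
    refine Submodule.add_mem_sup hci ?_
    rw [RingHom.mem_ker, map_sub, map_sub, hcj, ha, ha, map_sub]
    exact sub_self _
  simpa using add_mem (ha' i i j) h1

/-! ### Degrees and forms on the base -/

theorem incl_mem_deg (i : I) (a : Bi i) : (S.base i).incl a ∈ (S.base i).deg 0 := by
  rw [← (S.base i).range_incl]; exact ⟨a, rfl⟩

theorem one_mem_horDeg : (1 : S.hor) ∈ S.horDeg 0 := fun i =>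
  ⟨⟨1, SetLike.one_mem_graded _⟩ ⊗ₜ 1, by
    rw [LinearMap.comp_apply, LinearMap.rTensor_tmul, Submodule.subtype_apply,
      ← Algebra.TensorProduct.one_def, horIncl_one]; rfl⟩

theorem ofTotal_mem_horDeg (f : P) : S.ofTotal f ∈ S.horDeg 0 := by
  intro i
  rw [← component_apply, component_ofTotal]
  obtain ⟨z, hz⟩ : scalarExt k H (S.base i).incl (Q.χ i f) ∈
      LinearMap.range (((S.base i).deg 0).subtype.rTensor H) := by
    induction Q.χ i f with
    | zero => simp
    | add a b ha hb => rw [map_add]; exact add_mem ha hb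
    | tmul a h => exact ⟨⟨_, S.incl_mem_deg i a⟩ ⊗ₜ h, rfl⟩
  exact ⟨z, congrArg (S.horIncl i) hz⟩

theorem ofTotal_ι_mem_baseDeg (b : B) : S.ofTotal (Q.ι b) ∈ S.baseDeg 0 := fun i =>
  ⟨_, S.incl_mem_deg i (Q.π i b), by
    rw [← component_apply, component_ofTotal, Q.χ_ι, Algebra.TensorProduct.map_tmul]; rfl⟩

theorem _root_.QPFB.DifferentialAlgebra.d_one {A : Type*} [Ring A] [Algebra k A]
    (Γ : DifferentialAlgebra k A) : Γ.d 1 = 0 := by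
  have h := Γ.leibniz 0 1 (SetLike.one_mem_graded _) 1
  simpa using h

theorem tensorD_horIncl_tmul_one (i : I) (x : (S.base i).Form) :
    tensorD (S.base i) S.fibre.toDifferentialAlgebra (S.horIncl i (x ⊗ₜ 1)) =
      S.horIncl i ((S.base i).d x ⊗ₜ 1) := by
  have h : tensorD (S.base i) S.fibre.toDifferentialAlgebra (S.horIncl i (x ⊗ₜ 1)) =
      GradedTensorProduct.of k (S.base i).deg S.fibre.deg ((S.base i).d x ⊗ₜ S.fibre.incl 1) +
        GradedTensorProduct.of k (S.base i).deg S.fibre.deg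
          ((S.base i).sign x ⊗ₜ S.fibre.d (S.fibre.incl 1)) := rfl
  rw [h, map_one, DifferentialAlgebra.d_one, TensorProduct.tmul_zero, map_zero, add_zero,
    horIncl_tmul, map_one]

theorem mem_baseDeg_of_eq_locD {n : ℕ} {β γ : S.hor} (hβ : β ∈ S.baseDeg n)
    (h : (γ : S.LocForms) = S.locD β) : γ ∈ S.baseDeg (n + 1) := by
  intro i
  obtain ⟨x, hx, hx'⟩ := hβ i
  refine ⟨(S.base i).d x, (S.base i).d_mem n x hx, ?_⟩
  rw [h, ← tensorD_horIncl_tmul_one, ← hx']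
  rfl

/-- The fibre factor is `1` and `d 1 = 0`, so the differential of the tensor product reduces to that
of `Γ(B_i)`. -/
theorem locD_locD_of_mem_baseDeg {n : ℕ} {β : S.hor} (hβ : β ∈ S.baseDeg n) :
    S.locD (S.locD β) = 0 := by
  funext i
  obtain ⟨x, hx, hx'⟩ := hβ i
  change tensorD _ _ (tensorD _ _ ((β : S.LocForms) i)) = 0
  rw [hx', tensorD_horIncl_tmul_one, tensorD_horIncl_tmul_one, (S.base i).d_d,
    TensorProduct.zero_tmul, map_zero]

/-! ### The extension of gauge transformations to horizontal forms -/

theorem horIncl_coact (i : I) :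
    (S.horInclHom i).toLinearMap.rTensor H ∘ₗ trivCoact k H (S.base i).Form =
      S.locCoact i ∘ₗ (S.horInclHom i).toLinearMap :=
  LinearMap.ext fun c => (S.locCoact_horIncl i c).symm

theorem hor_tensor_ext {W : Type*} [AddCommMonoid W] [Module k W] {φ ψ : W →ₗ[k] S.hor ⊗[k] H}
    (h : ∀ i, (S.component i).toLinearMap.rTensor H ∘ₗ φ =
      (S.component i).toLinearMap.rTensor H ∘ₗ ψ) : φ = ψ :=
  LinearMap.ext fun w => S.horTensorLoc_injective (funext fun i => LinearMap.congr_fun (h i) w)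

/-- The map `γ ↦ ∑ γ₀ g(γ₁)` (for `s = true`) or `γ ↦ ∑ g(γ₁) γ₀` (for `s = false`) on a local
trivialization. -/
def locExtend (s : Bool) (g : H →ₗ[k] P) (i : I) : S.LocForm i →ₗ[k] S.LocForm i :=
  act s (S.locCoact i) LinearMap.id
    ((S.component i).toLinearMap ∘ₗ S.ofTotal.toLinearMap ∘ₗ g)

/-- Together with `component_comp_extend` this reduces each property of the extension on horizontal
forms to the trivial bundle `Γ(B_i) ⊗ H`. -/
theorem locExtend_comp_horIncl (s : Bool) (g : H →ₗ[k] P) (i : I) :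
    S.locExtend s g i ∘ₗ (S.horInclHom i).toLinearMap = (S.horInclHom i).toLinearMap ∘ₗ
      extendAct s (S.base i).incl ((Q.χ i).toLinearMap ∘ₗ g) := by
  rw [locExtend, ← act_comp s _ _ _ (S.horIncl_coact i), extendAct, map_act, LinearMap.id_comp,
    LinearMap.comp_id]
  rfl

variable [Finite I]

theorem component_coact (i : I) :
    (S.component i).toLinearMap.rTensor H ∘ₗ S.horCoact =
      S.locCoact i ∘ₗ (S.component i).toLinearMap :=
  LinearMap.ext fun γ => S.horCoact_spec γ i

theorem ofTotal_coact :
    S.ofTotal.toLinearMap.rTensor H ∘ₗ Q.coact.toLinearMap =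
      S.horCoact ∘ₗ S.ofTotal.toLinearMap := by
  refine S.hor_tensor_ext fun i => ?_
  rw [← LinearMap.comp_assoc, ← LinearMap.rTensor_comp, ← LinearMap.comp_assoc, component_coact]
  exact LinearMap.ext fun f => (S.locCoact_funLin i f).symm

/-- The map `γ ↦ ∑ γ₀ g(γ₁)` (for `s = true`) or `γ ↦ ∑ g(γ₁) γ₀` (for `s = false`) on horizontal
forms. -/
def extend (s : Bool) (g : H →ₗ[k] P) : S.hor →ₗ[k] S.hor :=
  act s S.horCoact LinearMap.id (S.ofTotal.toLinearMap ∘ₗ g)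

theorem rightExtend_eq (g : H →ₗ[k] P) : S.rightExtend g = S.extend false g :=
  LinearMap.ext fun γ =>
    (act_false S.horCoact LinearMap.id (S.ofTotal.toLinearMap ∘ₗ g) γ).symm

theorem component_comp_extend (s : Bool) (g : H →ₗ[k] P) (i : I) :
    (S.component i).toLinearMap ∘ₗ S.extend s g =
      S.locExtend s g i ∘ₗ (S.component i).toLinearMap := by
  rw [extend, map_act, LinearMap.comp_id, locExtend,
    ← act_comp s _ _ _ (S.component_coact i), LinearMap.id_comp]

theorem component_extend (s : Bool) (g : H →ₗ[k] P) (i : I) {γ : S.hor}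
    {c : (S.base i).Form ⊗[k] H} (hc : S.component i γ = S.horInclHom i c) :
    S.component i (S.extend s g γ) =
      S.horInclHom i (extendAct s (S.base i).incl ((Q.χ i).toLinearMap ∘ₗ g) c) := by
  have h1 := LinearMap.congr_fun (S.component_comp_extend s g i) γ
  have h2 := LinearMap.congr_fun (S.locExtend_comp_horIncl s g i) c
  simp only [LinearMap.comp_apply, AlgHom.toLinearMap_apply] at h1 h2
  rw [h1, hc, h2]

theorem extend_local (s : Bool) (g : H →ₗ[k] P) (i : I) (γ : S.hor)
    (hγ : (γ : S.LocForms) i = 0) : (S.extend s g γ : S.LocForms) i = 0 := by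
  rw [← component_apply] at hγ ⊢
  have h1 := LinearMap.congr_fun (S.component_comp_extend s g i) γ
  simp only [LinearMap.comp_apply, AlgHom.toLinearMap_apply] at h1
  rw [h1, hγ, map_zero]

/-- The extension is linear over base forms of every degree, not just over functions. The Leibniz
rule for `D'` needs this because it involves `dβ`. -/
theorem extend_base_sideMul (s : Bool) (g : H →ₗ[k] P) {n : ℕ} {β : S.hor} (hβ : β ∈ S.baseDeg n)
    (γ : S.hor) : S.extend s g (sideMul k s S.hor β γ) = sideMul k s S.hor β (S.extend s g γ) := by
  refine hor_ext fun i => ?_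
  obtain ⟨x, -, hx⟩ := hβ i
  obtain ⟨c, hc⟩ := S.exists_component_eq i γ
  rw [← component_apply, ← horInclHom_apply] at hx
  rw [map_sideMul, hx, S.component_extend s g i hc, ← map_sideMul, ← extendAct_sideMul]
  exact S.component_extend s g i (by rw [map_sideMul, hx, hc, map_sideMul])

variable {S} {s : Bool} {α : P ≃ₗ[k] P} {αi : ∀ i, (Bi i ⊗[k] H) ≃ₗ[k] (Bi i ⊗[k] H)}
  {g g' : H →ₗ[k] P}

theorem extend_extend_symm (hα : IsGauge s Q α αi)
    (hg : α.toLinearMap = act s Q.coact.toLinearMap LinearMap.id g)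
    (hg' : α.symm.toLinearMap = act s Q.coact.toLinearMap LinearMap.id g') (γ : S.hor) :
    S.extend s g' (S.extend s g γ) = γ := by
  refine hor_ext fun i => ?_
  obtain ⟨c, hc⟩ := S.exists_component_eq i γ
  rw [S.component_extend s g' i (S.component_extend s g i hc), hc]
  congr 1
  exact extendAct_symm _ (hα.triv_eq_act hg i) (hα.symm.triv_eq_act hg' i) c

theorem extend_coact (hα : IsGauge s Q α αi)
    (hg : α.toLinearMap = act s Q.coact.toLinearMap LinearMap.id g) :
    (S.extend s g).rTensor H ∘ₗ S.horCoact = S.horCoact ∘ₗ S.extend s g := by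
  refine S.hor_tensor_ext fun i => ?_
  rw [← LinearMap.comp_assoc, ← LinearMap.rTensor_comp, component_comp_extend,
    LinearMap.rTensor_comp, LinearMap.comp_assoc, component_coact, ← LinearMap.comp_assoc,
    ← LinearMap.comp_assoc _ S.horCoact, component_coact, LinearMap.comp_assoc _ _ (S.locCoact i),
    component_comp_extend]
  ext γ
  obtain ⟨c, hc⟩ := S.exists_component_eq i γ
  have h1 := S.locExtend_comp_horIncl s g i
  have h2 : ∀ y, S.locCoact i (S.horInclHom i y) =
      (S.horInclHom i).toLinearMap.rTensor H (trivCoact k H _ y) := fun y =>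
    (LinearMap.congr_fun (S.horIncl_coact i) y).symm
  have h3 := LinearMap.congr_fun h1 c
  have h4 := LinearMap.congr_fun
    (extendAct_coact (S.base i).incl (hα.triv i) (hα.triv_eq_act hg i)) c
  simp only [LinearMap.comp_apply, AlgHom.toLinearMap_apply] at h3 h4 ⊢
  rw [hc, h3, h2, h2, ← LinearMap.comp_apply, ← LinearMap.rTensor_comp, h1, LinearMap.rTensor_comp,
    LinearMap.comp_apply, h4]

theorem extend_one (hα : IsGauge s Q α αi)
    (hg : α.toLinearMap = act s Q.coact.toLinearMap LinearMap.id g) : S.extend s g 1 = 1 := by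
  refine hor_ext fun i => ?_
  rw [S.component_extend s g i (c := 1) (by rw [map_one, map_one]),
    extendAct_one _ (hα.triv i) (hα.triv_eq_act hg i), map_one, map_one]

theorem extend_mem_horDeg (hα : IsGauge s Q α αi)
    (hg : α.toLinearMap = act s Q.coact.toLinearMap LinearMap.id g) {n : ℕ} {γ : S.hor}
    (hγ : γ ∈ S.horDeg n) : S.extend s g γ ∈ S.horDeg n := by
  intro i
  obtain ⟨z, hz⟩ := hγ i
  obtain ⟨w, hw⟩ := extendAct_mem (S.base i).incl (hα.triv_eq_act hg i) (L := (S.base i).deg n)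
    (fun x hx a => by
      cases s
      · have := SetLike.mul_mem_graded (S.incl_mem_deg i a) hx
        rwa [zero_add] at this
      · exact SetLike.mul_mem_graded hx (S.incl_mem_deg i a)) _ ⟨z, rfl⟩
  refine ⟨w, ?_⟩
  rw [← component_apply, S.component_extend s g i hz.symm, ← hw]
  rfl

theorem extend_comp_ofTotal (hg : α.toLinearMap = act s Q.coact.toLinearMap LinearMap.id g) :
    S.extend s g ∘ₗ S.ofTotal.toLinearMap = S.ofTotal.toLinearMap ∘ₗ α.toLinearMap := by
  rw [extend, ← act_comp s _ _ _ S.ofTotal_coact, hg, map_act]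
  rfl

end DifferentialStructure

namespace DifferentialStructure

variable {k : Type*} [Field k] {B H P : Type*} [Ring B] [Algebra k B] [Ring H] [HopfAlgebra k H]
  [Ring P] [Algebra k P] {I : Type*} {Bi : I → Type*} [∀ i, Ring (Bi i)]
  [∀ i, Algebra k (Bi i)] {Q : Bundle k B H P Bi} {S : DifferentialStructure Q}

/-! ### Covariant derivatives and curvature -/

theorem sq_eq_zero_of_eq_locD {D : S.hor →ₗ[k] S.hor} {n : ℕ}
    (hD : ∀ m, ∀ β ∈ S.baseDeg m, (D β : S.LocForms) = S.locD β) {β : S.hor}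
    (hβ : β ∈ S.baseDeg n) : D (D β) = 0 := by
  apply Subtype.ext
  rw [hD (n + 1) _ (S.mem_baseDeg_of_eq_locD hβ (hD n β hβ)), hD n β hβ,
    S.locD_locD_of_mem_baseDeg hβ]
  rfl

/-- `D² f = ∑ f₀ Ω(f₁)` (for `s = true`) or `D² f = ∑ Ω(f₁) f₀` (for `s = false`). -/
def IsCurvature (s : Bool) (D : S.hor →ₗ[k] S.hor) (Ω : H →ₗ[k] S.hor) : Prop :=
  D ∘ₗ D ∘ₗ S.ofTotal.toLinearMap = act s Q.coact.toLinearMap S.ofTotal.toLinearMap Ω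

theorem IsCurvature.unique {s : Bool} {D : S.hor →ₗ[k] S.hor} {A : H →ₗ[k] H} (hA : IsSideAntipode s A) {Ω Ω' : H →ₗ[k] S.hor}
    (h : IsCurvature s D Ω) (h' : IsCurvature s D Ω') : Ω = Ω' :=
  S.isLocalization_hor.act_injective S.eq_zero_of_forall_component hA Ω Ω' (h.symm.trans h')

theorem sideMul_horIncl_mem (s : Bool) (i : I) (n : ℕ) (f : P) {x : S.LocForm i}
    (hx : x ∈ LinearMap.range (S.horIncl i ∘ₗ ((S.base i).deg n).subtype.rTensor H)) :
    sideMul k s _ (S.component i (S.ofTotal f)) x ∈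
      LinearMap.range (S.horIncl i ∘ₗ ((S.base i).deg n).subtype.rTensor H) := by
  obtain ⟨z, rfl⟩ := hx
  have h : ∀ y : Bi i ⊗[k] H, sideMul k s _ (scalarExt k H (S.base i).incl y)
      (((S.base i).deg n).subtype.rTensor H z) ∈
        LinearMap.range (((S.base i).deg n).subtype.rTensor H) := by
    intro y
    induction y with
    | zero => simp
    | add a b ha hb => rw [map_add, map_add, LinearMap.add_apply]; exact add_mem ha hb
    | tmul a h =>
      induction z with
      | zero => simp
      | add z w hz hw => rw [map_add, map_add]; exact add_mem hz hw
      | tmul x h' =>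
        rw [Algebra.TensorProduct.map_tmul, LinearMap.rTensor_tmul, sideMul_tmul]
        refine ⟨⟨_, ?_⟩ ⊗ₜ _, rfl⟩
        cases s
        · exact SetLike.mul_mem_graded x.2 (S.incl_mem_deg i a)
        · have := SetLike.mul_mem_graded (S.incl_mem_deg i a) x.2
          rwa [zero_add] at this
  obtain ⟨w, hw⟩ := h (Q.χ i f)
  refine ⟨w, ?_⟩
  rw [LinearMap.comp_apply, hw, component_ofTotal, LinearMap.comp_apply, ← horInclHom_apply,
    ← horInclHom_apply, map_sideMul]

variable [Finite I]

/-- Taking `γ = 1` and using `D 1 = 0` shows that `D` is `d` on base forms. Hence `dβ` is horizontal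
and the Leibniz rule can be stated inside `hor`. -/
theorem leibniz_hor {D : S.hor →ₗ[k] S.hor} (hD : S.IsLeftCovariantDerivative D) {n : ℕ}
    {β : S.hor} (hβ : β ∈ S.baseDeg n) :
    (D β : S.LocForms) = S.locD β ∧
      ∀ γ, D (β * γ) = D β * γ + (-1 : k) ^ n • (β * D γ) := by
  have h : (D β : S.LocForms) = S.locD β := by
    have := hD.leibniz n β hβ 1
    rw [hD.one] at this
    simpa using this
  refine ⟨h, fun γ => Subtype.ext ?_⟩
  rw [hD.leibniz n β hβ γ, ← h]
  rfl

theorem leibniz_hor_right {D : S.hor →ₗ[k] S.hor} (hD : S.IsRightCovariantDerivative D) {m : ℕ}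
    {β : S.hor} (hβ : β ∈ S.baseDeg m) :
    (D β : S.LocForms) = S.locD β ∧
      ∀ n, ∀ γ ∈ S.horDeg n, D (γ * β) = D γ * β + (-1 : k) ^ n • (γ * D β) := by
  have h : (D β : S.LocForms) = S.locD β := by
    have := hD.leibniz 0 1 S.one_mem_horDeg m β hβ
    rw [hD.one] at this
    simpa using this
  refine ⟨h, fun n γ hγ => Subtype.ext ?_⟩
  rw [hD.leibniz n γ hγ m β hβ, ← h]
  rfl

/-- The two terms `Dβ Dγ` have opposite signs since `Dβ` has degree one, and `D² β = d² β = 0`. -/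
theorem IsLeftCovariantDerivative.sq_base_mul {D : S.hor →ₗ[k] S.hor}
    (hD : S.IsLeftCovariantDerivative D) {β : S.hor} (hβ : β ∈ S.baseDeg 0) (γ : S.hor) :
    D (D (β * γ)) = β * D (D γ) := by
  have h0 := sq_eq_zero_of_eq_locD (fun m b hb => (leibniz_hor hD hb).1) hβ
  have h1 := S.mem_baseDeg_of_eq_locD hβ (leibniz_hor hD hβ).1
  rw [(leibniz_hor hD hβ).2, map_add, (leibniz_hor hD h1).2, map_smul, (leibniz_hor hD hβ).2, h0]
  simp

/-- Here the sign in the Leibniz rule comes from the degree of `γ`, so `γ` must be homogeneous.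
Degree zero covers the elements of `P`. -/
theorem IsRightCovariantDerivative.sq_mul_base {D : S.hor →ₗ[k] S.hor}
    (hD : S.IsRightCovariantDerivative D) {β : S.hor} (hβ : β ∈ S.baseDeg 0) {γ : S.hor}
    (hγ : γ ∈ S.horDeg 0) : D (D (γ * β)) = D (D γ) * β := by
  have h0 := sq_eq_zero_of_eq_locD (fun m b hb => (leibniz_hor_right hD hb).1) hβ
  have h1 := S.mem_baseDeg_of_eq_locD hβ (leibniz_hor_right hD hβ).1
  rw [(leibniz_hor_right hD hβ).2 0 γ hγ, map_add,
    (leibniz_hor_right hD hβ).2 1 _ (hD.degree 0 γ hγ), map_smul,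
    (leibniz_hor_right hD h1).2 0 γ hγ, h0]
  simp

/-- The properties of covariant derivatives that do not refer to a side. -/
structure IsHorizontalDerivative (D : S.hor →ₗ[k] S.hor) : Prop where
  degree : ∀ n, ∀ γ ∈ S.horDeg n, D γ ∈ S.horDeg (n + 1)
  one : D 1 = 0
  covariant : D.rTensor H ∘ₗ S.horCoact = S.horCoact ∘ₗ D
  local_ker : ∀ i, ∀ γ : S.hor, (γ : S.LocForms) i = 0 → (D γ : S.LocForms) i = 0

theorem IsLeftCovariantDerivative.isHorizontalDerivative {D : S.hor →ₗ[k] S.hor}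
    (hD : S.IsLeftCovariantDerivative D) : IsHorizontalDerivative D :=
  ⟨hD.degree, hD.one, hD.covariant, hD.local_ker⟩

theorem IsRightCovariantDerivative.isHorizontalDerivative {D : S.hor →ₗ[k] S.hor}
    (hD : S.IsRightCovariantDerivative D) : IsHorizontalDerivative D :=
  ⟨hD.degree, hD.one, hD.covariant, hD.local_ker⟩

theorem rTensor_comp_coact {V : Type*} [AddCommMonoid V] [Module k V] {δ : V →ₗ[k] V ⊗[k] H}
    {X : V →ₗ[k] S.hor} {D : S.hor →ₗ[k] S.hor} (hX : X.rTensor H ∘ₗ δ = S.horCoact ∘ₗ X)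
    (hD : D.rTensor H ∘ₗ S.horCoact = S.horCoact ∘ₗ D) :
    (D ∘ₗ X).rTensor H ∘ₗ δ = S.horCoact ∘ₗ D ∘ₗ X := by
  rw [LinearMap.rTensor_comp, LinearMap.comp_assoc, hX, ← LinearMap.comp_assoc, hD,
    LinearMap.comp_assoc]

variable {s : Bool} {α : P ≃ₗ[k] P} {αi : ∀ i, (Bi i ⊗[k] H) ≃ₗ[k] (Bi i ⊗[k] H)}
  {g g' : H →ₗ[k] P} {D : S.hor →ₗ[k] S.hor}

theorem IsHorizontalDerivative.conj (hD : IsHorizontalDerivative D) (hα : IsGauge s Q α αi)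
    (hg : α.toLinearMap = act s Q.coact.toLinearMap LinearMap.id g)
    (hg' : α.symm.toLinearMap = act s Q.coact.toLinearMap LinearMap.id g') :
    IsHorizontalDerivative (S.extend s g ∘ₗ D ∘ₗ S.extend s g') where
  degree n γ hγ := extend_mem_horDeg hα hg (hD.degree n _ (extend_mem_horDeg hα.symm hg' hγ))
  one := by
    rw [LinearMap.comp_apply, LinearMap.comp_apply, extend_one hα.symm hg', hD.one, map_zero]
  covariant := rTensor_comp_coact (rTensor_comp_coact (extend_coact hα.symm hg') hD.covariant)
    (extend_coact hα hg)
  local_ker i γ hγ := S.extend_local s g i _ (hD.local_ker i _ (S.extend_local s g' i γ hγ))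

theorem extend_symm_extend (hα : IsGauge s Q α αi)
    (hg : α.toLinearMap = act s Q.coact.toLinearMap LinearMap.id g)
    (hg' : α.symm.toLinearMap = act s Q.coact.toLinearMap LinearMap.id g') (γ : S.hor) :
    S.extend s g (S.extend s g' γ) = γ :=
  extend_extend_symm hα.symm hg' hg γ

/-- Both `β` and `Dβ = dβ` are base forms, so the extensions of `α` and `α⁻¹` pass over them and
cancel in the term `dβ γ`. -/
theorem IsLeftCovariantDerivative.conj (hD : S.IsLeftCovariantDerivative D)
    (hα : IsGauge true Q α αi)
    (hg : α.toLinearMap = act true Q.coact.toLinearMap LinearMap.id g)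
    (hg' : α.symm.toLinearMap = act true Q.coact.toLinearMap LinearMap.id g') :
    S.IsLeftCovariantDerivative (S.extend true g ∘ₗ D ∘ₗ S.extend true g') := by
  have h := hD.isHorizontalDerivative.conj hα hg hg'
  refine ⟨h.degree, h.one, fun n β hβ γ => ?_, h.covariant, h.local_ker⟩
  have hmul : ∀ (g : H →ₗ[k] P) (m : ℕ) (b x : S.hor), b ∈ S.baseDeg m →
      S.extend true g (b * x) = b * S.extend true g x := fun g m b x hb =>
    S.extend_base_sideMul true g hb x
  have h1 := S.mem_baseDeg_of_eq_locD hβ (leibniz_hor hD hβ).1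
  have h2 : (S.extend true g ∘ₗ D ∘ₗ S.extend true g') (β * γ) =
      D β * γ + (-1 : k) ^ n • (β * (S.extend true g ∘ₗ D ∘ₗ S.extend true g') γ) := by
    simp only [LinearMap.comp_apply]
    rw [hmul g' n β _ hβ, (leibniz_hor hD hβ).2, map_add, map_smul, hmul g _ _ _ h1,
      hmul g _ _ _ hβ, extend_symm_extend hα hg hg']
  rw [h2, ← (leibniz_hor hD hβ).1]
  rfl

theorem IsRightCovariantDerivative.conj (hD : S.IsRightCovariantDerivative D)
    (hα : IsGauge false Q α αi)
    (hg : α.toLinearMap = act false Q.coact.toLinearMap LinearMap.id g)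
    (hg' : α.symm.toLinearMap = act false Q.coact.toLinearMap LinearMap.id g') :
    S.IsRightCovariantDerivative (S.extend false g ∘ₗ D ∘ₗ S.extend false g') := by
  have h := hD.isHorizontalDerivative.conj hα hg hg'
  refine ⟨h.degree, h.one, fun n γ hγ m β hβ => ?_, h.covariant, h.local_ker⟩
  have hmul : ∀ (g : H →ₗ[k] P) (m : ℕ) (b x : S.hor), b ∈ S.baseDeg m →
      S.extend false g (x * b) = S.extend false g x * b := fun g m b x hb =>
    S.extend_base_sideMul false g hb x
  have h1 := S.mem_baseDeg_of_eq_locD hβ (leibniz_hor_right hD hβ).1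
  have h2 : (S.extend false g ∘ₗ D ∘ₗ S.extend false g') (γ * β) =
      (S.extend false g ∘ₗ D ∘ₗ S.extend false g') γ * β + (-1 : k) ^ n • (γ * D β) := by
    simp only [LinearMap.comp_apply]
    rw [hmul g' m β _ hβ, (leibniz_hor_right hD hβ).2 n _ (extend_mem_horDeg hα.symm hg' hγ),
      map_add, map_smul, hmul g _ _ _ hβ, hmul g _ _ _ h1, extend_symm_extend hα hg hg']
  rw [h2, ← (leibniz_hor_right hD hβ).1]
  rfl

/-! ### Curvature forms -/

/-- The instance `F = D²` of `exists_act`, with values in the horizontal forms. Locality of `F` is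
that of `D`, and `overlapKer` describes the overlaps. -/
theorem IsHorizontalDerivative.exists_isCurvature (hD : IsHorizontalDerivative D)
    {A : H →ₗ[k] H} (hA : IsSideAntipode s A)
    (hB : ∀ b f, D (D (S.ofTotal (sideMul k s P (Q.ι b) f))) =
      sideMul k s S.hor (S.ofTotal (Q.ι b)) (D (D (S.ofTotal f)))) :
    ∃ Ω, IsCurvature s D Ω := by
  refine S.isLocalization_hor.exists_act S.eq_zero_of_forall_component hA S.overlapKer
    (fun i j f x => S.sideMul_mem_overlapKer s i j f x) (fun i j x => S.mem_overlapKer_left)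
    (fun i j x hx => S.overlapKer_symm (S.mem_overlapKer_left hx)) S.exists_glue
    (D ∘ₗ D ∘ₗ S.ofTotal.toLinearMap) hB fun i f hf => ?_
  refine hD.local_ker i _ (hD.local_ker i _ ?_)
  change S.component i (S.ofTotal f) = 0
  rw [component_ofTotal, hf, map_zero, map_zero]

/-- `D²` maps `P` into degree two, and the inversion by the antipode stays there: `mem_of_act_mem`
applies with `L` the forms whose `i`-th component has degree two. -/
theorem IsCurvature.mem_horDeg {A : H →ₗ[k] H} (hA : IsSideAntipode s A) {Ω : H →ₗ[k] S.hor}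
    (hΩ : IsCurvature s D Ω) (hD : IsHorizontalDerivative D) (h : H) : Ω h ∈ S.horDeg 2 := by
  intro i
  refine S.isLocalization_hor.mem_of_act_mem hA i
    ((LinearMap.range (S.horIncl i ∘ₗ ((S.base i).deg 2).subtype.rTensor H)).comap
      (S.component i).toLinearMap) ?_ ?_ Ω ?_ h
  · intro f x hx
    rw [Submodule.mem_comap, AlgHom.toLinearMap_apply] at hx ⊢
    rw [map_sideMul]
    exact sideMul_horIncl_mem s i 2 f hx
  · intro x hx
    rw [Submodule.mem_comap, AlgHom.toLinearMap_apply, hx]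
    exact zero_mem _
  · intro f
    have h1 : D (D (S.ofTotal f)) = _ := LinearMap.congr_fun hΩ f
    rw [← h1]
    exact hD.degree 1 _ (hD.degree 0 _ (S.ofTotal_mem_horDeg f)) i

theorem isLeftCurvatureForm_iff {A : H →ₗ[k] H} (hA : IsSideAntipode true A)
    (hD : IsHorizontalDerivative D) {Ω : H →ₗ[k] S.hor} (hΩ : IsCurvature true D Ω)
    (X : H →ₗ[k] S.hor) : S.IsLeftCurvatureForm D X ↔ X = Ω := by
  constructor
  · intro h
    exact IsCurvature.unique hA (LinearMap.ext h.sq) hΩ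
  · rintro rfl
    exact ⟨hΩ.mem_horDeg hA hD, LinearMap.congr_fun hΩ⟩

theorem isRightCurvatureForm_iff {A : H →ₗ[k] H} (hA : IsSideAntipode false A)
    (hD : IsHorizontalDerivative D) {Ω : H →ₗ[k] S.hor} (hΩ : IsCurvature false D Ω)
    (X : H →ₗ[k] S.hor) : S.IsRightCurvatureForm D X ↔ X = Ω := by
  have e : ∀ Y : H →ₗ[k] S.hor, ∀ f, act false Q.coact.toLinearMap S.ofTotal.toLinearMap Y f =
      LinearMap.mul' k S.hor (TensorProduct.comm k S.hor S.hor
        (TensorProduct.map S.ofTotal.toLinearMap Y (Q.coact f))) := fun Y f =>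
    act_false Q.coact.toLinearMap S.ofTotal.toLinearMap Y f
  constructor
  · intro h
    exact IsCurvature.unique hA (LinearMap.ext fun f => (h.sq f).trans (e X f).symm) hΩ
  · rintro rfl
    exact ⟨hΩ.mem_horDeg hA hD, fun f => (LinearMap.congr_fun hΩ f).trans (e X f)⟩

/-- The transformation of the curvature under gauge transformations. -/
theorem IsCurvature.conj {Ω : H →ₗ[k] S.hor} (hΩ : IsCurvature s D Ω)
    (hD : IsHorizontalDerivative D) (hα : IsGauge s Q α αi)
    (hg : α.toLinearMap = act s Q.coact.toLinearMap LinearMap.id g)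
    (hg' : α.symm.toLinearMap = act s Q.coact.toLinearMap LinearMap.id g') :
    IsCurvature s (S.extend s g ∘ₗ D ∘ₗ S.extend s g')
      (act s (Coalgebra.comul (R := k)) (S.ofTotal.toLinearMap ∘ₗ g')
        (act s (Coalgebra.comul (R := k)) Ω (S.ofTotal.toLinearMap ∘ₗ g))) := by
  have h1 : (S.extend s g ∘ₗ D ∘ₗ S.extend s g') ∘ₗ (S.extend s g ∘ₗ D ∘ₗ S.extend s g') ∘ₗ
      S.ofTotal.toLinearMap = S.extend s g ∘ₗ D ∘ₗ D ∘ₗ S.extend s g' ∘ₗ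
        S.ofTotal.toLinearMap := by
    ext1 f
    simp only [LinearMap.comp_apply]
    rw [extend_extend_symm hα hg hg']
  -- `h2` and `h3` record that `f ↦ α⁻¹ f` and `f ↦ D² α⁻¹ f` are colinear on `P`. The coaction of
  -- `H` may therefore be taken on `f` before these maps are applied.
  have h2 := rTensor_comp_coact S.ofTotal_coact (extend_coact hα.symm hg')
  have h3 := rTensor_comp_coact (rTensor_comp_coact h2 hD.covariant) hD.covariant
  have h4 : S.extend s g' ∘ₗ S.ofTotal.toLinearMap =
      act s Q.coact.toLinearMap S.ofTotal.toLinearMap (S.ofTotal.toLinearMap ∘ₗ g') := by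
    rw [extend_comp_ofTotal hg', hg', map_act]
    rfl
  -- `D² α⁻¹ f = ∑ α⁻¹(f₀) Ω(f₁)`: the curvature formula at `α⁻¹ f`, combined with colinearity of
  -- `α⁻¹`.
  have h5 : D ∘ₗ D ∘ₗ S.extend s g' ∘ₗ S.ofTotal.toLinearMap =
      act s Q.coact.toLinearMap (S.extend s g' ∘ₗ S.ofTotal.toLinearMap) Ω := by
    have h6 : D ∘ₗ D ∘ₗ S.ofTotal.toLinearMap = act s S.horCoact LinearMap.id Ω ∘ₗ
        S.ofTotal.toLinearMap := by
      rw [hΩ, ← act_comp s _ _ _ S.ofTotal_coact, LinearMap.id_comp]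
    have h7 := congrArg (· ∘ₗ α.symm.toLinearMap) h6
    simp only [LinearMap.comp_assoc] at h7
    rw [extend_comp_ofTotal hg', h7, ← extend_comp_ofTotal hg', ← act_comp s _ _ _ h2,
      LinearMap.id_comp]
  -- Applying `α` to `D² α⁻¹ f` gives `∑ D² α⁻¹(f₀) g(f₁)`. Substituting `h5` and `h4` yields `((f₀
  -- g'(f₁)) Ω(f₂)) g(f₃)`, and two uses of `act_assoc` move all the maps on `H` into one
  -- convolution.
  rw [IsCurvature, h1, extend, ← act_comp s _ _ _ h3, LinearMap.id_comp, h5, h4,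
    act_assoc s _ Q.coact_coassoc, act_assoc s _ Q.coact_coassoc]

end DifferentialStructure
end QPFB
end

/-! ### Assembly of the left and the right case. -/

theorem proposition13 {k : Type*} [Field k] {B H P : Type*} [Ring B] [Algebra k B] [Ring H]
    [HopfAlgebra k H] [Ring P] [Algebra k P] {I : Type*} [Finite I] {Bi : I → Type*}
    [∀ i, Ring (Bi i)] [∀ i, Algebra k (Bi i)] (Q : QPFB.Bundle k B H P Bi)
    (S : QPFB.DifferentialStructure Q) :
    (∀ (α : P ≃ₗ[k] P) (D : S.hor →ₗ[k] S.hor),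
      QPFB.IsLeftGauge Q α → S.IsLeftCovariantDerivative D →
      ∃ (g g' : H →ₗ[k] P) (αΓ : S.hor ≃ₗ[k] S.hor) (D' : S.hor →ₗ[k] S.hor)
        (Ω Ω' : H →ₗ[k] S.hor),
        (∀ x : H →ₗ[k] P, QPFB.IsLeftGaugeMap Q α x ↔ x = g) ∧
        (∀ x : H →ₗ[k] P, QPFB.IsLeftGaugeMap Q α.symm x ↔ x = g') ∧
        (∀ γ : S.hor, αΓ γ = S.leftExtend g γ) ∧
        D' = αΓ.toLinearMap ∘ₗ D ∘ₗ αΓ.symm.toLinearMap ∧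
        S.IsLeftCovariantDerivative D' ∧
        D' ∘ₗ D' = αΓ.toLinearMap ∘ₗ (D ∘ₗ D) ∘ₗ αΓ.symm.toLinearMap ∧
        (∀ X : H →ₗ[k] S.hor, S.IsLeftCurvatureForm D X ↔ X = Ω) ∧
        (∀ X : H →ₗ[k] S.hor, S.IsLeftCurvatureForm D' X ↔ X = Ω') ∧
        ∀ h : H, Ω' h = QPFB.conv (S.ofTotal.toLinearMap ∘ₗ g')
          (QPFB.conv Ω (S.ofTotal.toLinearMap ∘ₗ g)) h) ∧
    (Function.Bijective (HopfAlgebra.antipode k : H →ₗ[k] H) →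
      ∀ (α : P ≃ₗ[k] P) (D : S.hor →ₗ[k] S.hor),
      QPFB.IsRightGauge Q α → S.IsRightCovariantDerivative D →
      ∃ (g g' : H →ₗ[k] P) (αΓ : S.hor ≃ₗ[k] S.hor) (D' : S.hor →ₗ[k] S.hor)
        (Ω Ω' : H →ₗ[k] S.hor),
        (∀ x : H →ₗ[k] P, QPFB.IsRightGaugeMap Q α x ↔ x = g) ∧
        (∀ x : H →ₗ[k] P, QPFB.IsRightGaugeMap Q α.symm x ↔ x = g') ∧
        (∀ γ : S.hor, αΓ γ = S.rightExtend g γ) ∧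
        D' = αΓ.toLinearMap ∘ₗ D ∘ₗ αΓ.symm.toLinearMap ∧
        S.IsRightCovariantDerivative D' ∧
        D' ∘ₗ D' = αΓ.toLinearMap ∘ₗ (D ∘ₗ D) ∘ₗ αΓ.symm.toLinearMap ∧
        (∀ X : H →ₗ[k] S.hor, S.IsRightCurvatureForm D X ↔ X = Ω) ∧
        (∀ X : H →ₗ[k] S.hor, S.IsRightCurvatureForm D' X ↔ X = Ω') ∧
        ∀ h : H, Ω' h = QPFB.twistedConv (S.ofTotal.toLinearMap ∘ₗ g)
          (QPFB.twistedConv Ω (S.ofTotal.toLinearMap ∘ₗ g')) h) := by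
  have hsq : ∀ (e : S.hor ≃ₗ[k] S.hor) (D : S.hor →ₗ[k] S.hor),
      (e.toLinearMap ∘ₗ D ∘ₗ e.symm.toLinearMap) ∘ₗ (e.toLinearMap ∘ₗ D ∘ₗ e.symm.toLinearMap) =
        e.toLinearMap ∘ₗ (D ∘ₗ D) ∘ₗ e.symm.toLinearMap := fun e D => by
    ext1 γ
    simp
  refine ⟨fun α D hα hD => ?_, fun hS α D hα hD => ?_⟩
  · have hA := QPFB.isSideAntipode_true (k := k) (H := H)
    obtain ⟨αi, hα⟩ := hα.exists_isGauge
    obtain ⟨g, hg⟩ := hα.exists_map hA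
    obtain ⟨g', hg'⟩ := hα.symm.exists_map hA
    let αΓ : S.hor ≃ₗ[k] S.hor := LinearEquiv.ofLinearMap (S.extend true g) (S.extend true g')
      (LinearMap.ext (QPFB.DifferentialStructure.extend_symm_extend hα hg hg'))
      (LinearMap.ext (QPFB.DifferentialStructure.extend_extend_symm hα hg hg'))
    obtain ⟨Ω, hΩ⟩ := hD.isHorizontalDerivative.exists_isCurvature hA fun b f =>
      (congrArg (fun x => D (D x)) (map_mul S.ofTotal (Q.ι b) f)).trans
        (hD.sq_base_mul (S.ofTotal_ι_mem_baseDeg b) (S.ofTotal f))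
    refine ⟨g, g', αΓ, αΓ.toLinearMap ∘ₗ D ∘ₗ αΓ.symm.toLinearMap, Ω, _, fun x => ?_, fun x => ?_,
      fun γ => rfl, rfl, hD.conj hα hg hg', hsq αΓ D,
      QPFB.DifferentialStructure.isLeftCurvatureForm_iff hA hD.isHorizontalDerivative hΩ,
      QPFB.DifferentialStructure.isLeftCurvatureForm_iff hA
        (hD.isHorizontalDerivative.conj hα hg hg')
        (hΩ.conj hD.isHorizontalDerivative hα hg hg'), fun h => rfl⟩
    · rw [QPFB.isLeftGaugeMap_iff, hg]
      exact ⟨fun h => (QPFB.gaugeMap_unique hA h).symm, fun h => by rw [h]⟩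
    · rw [QPFB.isLeftGaugeMap_iff, hg']
      exact ⟨fun h => (QPFB.gaugeMap_unique hA h).symm, fun h => by rw [h]⟩
  · obtain ⟨A, hA⟩ := QPFB.exists_isSideAntipode_false hS
    obtain ⟨αi, hα⟩ := hα.exists_isGauge
    obtain ⟨g, hg⟩ := hα.exists_map hA
    obtain ⟨g', hg'⟩ := hα.symm.exists_map hA
    let αΓ : S.hor ≃ₗ[k] S.hor := LinearEquiv.ofLinearMap (S.extend false g) (S.extend false g')
      (LinearMap.ext (QPFB.DifferentialStructure.extend_symm_extend hα hg hg'))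
      (LinearMap.ext (QPFB.DifferentialStructure.extend_extend_symm hα hg hg'))
    obtain ⟨Ω, hΩ⟩ := hD.isHorizontalDerivative.exists_isCurvature hA fun b f =>
      (congrArg (fun x => D (D x)) (map_mul S.ofTotal f (Q.ι b))).trans
        (hD.sq_mul_base (S.ofTotal_ι_mem_baseDeg b) (S.ofTotal_mem_horDeg f))
    refine ⟨g, g', αΓ, αΓ.toLinearMap ∘ₗ D ∘ₗ αΓ.symm.toLinearMap, Ω, _, fun x => ?_, fun x => ?_,
      fun γ => (LinearMap.congr_fun (S.rightExtend_eq g) γ).symm, rfl, hD.conj hα hg hg', hsq αΓ D,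
      QPFB.DifferentialStructure.isRightCurvatureForm_iff hA hD.isHorizontalDerivative hΩ,
      QPFB.DifferentialStructure.isRightCurvatureForm_iff hA
        (hD.isHorizontalDerivative.conj hα hg hg')
        (hΩ.conj hD.isHorizontalDerivative hα hg hg'), fun h => ?_⟩
    · rw [QPFB.isRightGaugeMap_iff, hg]
      exact ⟨fun h => (QPFB.gaugeMap_unique hA h).symm, fun h => by rw [h]⟩
    · rw [QPFB.isRightGaugeMap_iff, hg']
      exact ⟨fun h => (QPFB.gaugeMap_unique hA h).symm, fun h => by rw [h]⟩
    -- The twisted convolution is the opposite one with its arguments exchanged, so the two sides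
    -- differ only in their bracketing.
    · rw [QPFB.twistedConv_eq_act, QPFB.twistedConv_eq_act, QPFB.act_comul_assoc]
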